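/- **Ancilla uncomputation for general matrices.** Conventions: an $(n+a)$-qubit unitary $V$ is an $(\alpha,a,\epsilon)$-block encoding of a $2^n\times 2^n$ complex matrix $A$ if $\|A-\alpha\,(\langle 0^a|\otimes I)V(|0^a\rangle\otimes I)\|\le\epsilon$ (operator norm). A quantum circuit with oracle $V$ is a finite product of unitaries that do not depend on $V$ and of queries, each query being an application of $V$ or $V^\dagger$, possibly controlled on an additional ancilla qubit. There are universal constants $c\in\mathbb N$ and $C>0$ such that the following holds. Let $n,a\in\mathbb N$, $\delta\in(0,1)$ and $\epsilon\in(0,1)$. There is a quantum circuit on the $n$ system qubits, the $a$ ancilla qubits of the oracle and $c+1$ additional ancilla qubits, which depends only on $n,a,\delta,\epsilon$ and makes at most $\frac{C}{\delta}\log\frac{2}{\epsilon}$ queries to $V_A$ and $V_A^\dagger$ (that is, $O(\frac1\delta\log\frac1\epsilon)$ queries when $\epsilon\le\frac12$), such that for every $2^n\times2^n$ complex (not necessarily Hermitian) matrix $A$ with $\|A\|\le 1-\delta$ and every $(1,a,0)$-block encoding $V_A$ of $A$, the following is true. 1. The $(n+1)$-qubit matrix $$U_A=\begin{pmatrix}\sqrt{I-A^\dagger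 A}&A^\dagger\\A&-\sqrt{I-AA^\dagger}\end{pmatrix}$$ is Hermitian and unitary, and $(X\otimes I)U_A$, with $X$ the Pauli gate on the single ancilla qubit, is a $(1,1,0)$-block encoding of $A$ (equivalently, $(\langle 1|\otimes I)U_A(|0\rangle\otimes I)=A$). 2. The unitary $W$ that the circuit implements with oracle $V_A$ applies $(X\otimes I)U_A$ to one fixed additional ancilla qubit and the system, up to error $\epsilon$, and returns all the other $a+c$ ancilla qubits to $|0\rangle$: for every $(n+1)$-qubit vector $\psi$, $$\big\|W\,(|0^{a+c}\rangle\otimes\psi)-|0^{a+c}\rangle\otimes (X\otimes I)U_A\psi\big\|\le\epsilon\|\psi\| .$$ 3. In particular, $\widetilde U=(\langle 0^{a+c}|\otimes I)W(|0^{a+c}\rangle\otimes I)$ is an $\epsilon$-precise single-ancilla block encoding of $A$: $\|A-(\langle0|\otimes I)\widetilde U(|0\rangle\otimes I)\|\le\epsilon$. -/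

import Mathlib

open scoped Matrix Kronecker Matrix.Norms.L2Operator MatrixOrder

/-- Computational basis labels of a register of `k` qubits. -/
abbrev Qubits (k : ℕ) : Type := Fin k → Fin 2

/-- The block `⟨0^a| U |0^a⟩` of an operator on `a` ancilla qubits and `n` system qubits. -/
def zeroBlock {a n : ℕ} (U : Matrix (Qubits a × Qubits n) (Qubits a × Qubits n) ℂ) :
    Matrix (Qubits n) (Qubits n) ℂ :=
  Matrix.of fun x y => U (0, x) (0, y)

/-- `U` is an `(α, a, ε)`-block encoding of the `n`-qubit matrix `A`: it is unitary and
`‖A - α ⟨0^a| U |0^a⟩‖ ≤ ε` in operator norm. -/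
def IsBlockEncoding {a n : ℕ} (α ε : ℝ) (A : Matrix (Qubits n) (Qubits n) ℂ)
    (U : Matrix (Qubits a × Qubits n) (Qubits a × Qubits n) ℂ) : Prop :=
  U ∈ Matrix.unitaryGroup (Qubits a × Qubits n) ℂ ∧ ‖A - α • zeroBlock U‖ ≤ ε

/-- Basis labels of the whole register of a circuit: `c` additional ancillae, the `a` ancillae
of the queried block encoding, and `n` system qubits. -/
abbrev Register (c a n : ℕ) : Type := Qubits c × (Qubits a × Qubits n)

/-- The elementary steps of a circuit with oracle access to an `(a + n)`-qubit unitary `V`.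
`fixed U` applies a unitary that does not depend on `V`; `query adj ctrl` applies `V`
(`adj = false`) or `V†` (`adj = true`) to the last `a + n` qubits, either unconditionally
(`ctrl = none`) or controlled on the `j`-th additional ancilla (`ctrl = some j`). -/
inductive Gate (c a n : ℕ) : Type
  | fixed (U : Matrix.unitaryGroup (Register c a n) ℂ) : Gate c a n
  | query (adj : Bool) (ctrl : Option (Fin c)) : Gate c a n

/-- The gate `∑_z |z⟩⟨z| ⊗ (Q if the control qubit of z is 1, otherwise the identity)`. With no
control qubit it is `I ⊗ Q`. -/
def controlled {c a n : ℕ} (ctrl : Option (Fin c))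
    (Q : Matrix (Qubits a × Qubits n) (Qubits a × Qubits n) ℂ) :
    Matrix (Register c a n) (Register c a n) ℂ :=
  Matrix.of fun p q =>
    if p.1 = q.1 then
      (if ∀ j ∈ ctrl, q.1 j = 1 then Q p.2 q.2
        else (1 : Matrix (Qubits a × Qubits n) (Qubits a × Qubits n) ℂ) p.2 q.2)
    else 0

/-- The operator that a gate applies when the oracle is `V`. -/
def Gate.toMatrix {c a n : ℕ} (V : Matrix (Qubits a × Qubits n) (Qubits a × Qubits n) ℂ) :
    Gate c a n → Matrix (Register c a n) (Register c a n) ℂ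
  | .fixed U => U
  | .query false ctrl => controlled ctrl V
  | .query true ctrl => controlled ctrl Vᴴ

/-- The number of queries to `V` or `V†` made by a gate. -/
def Gate.queries {c a n : ℕ} : Gate c a n → ℕ
  | .fixed _ => 0
  | .query _ _ => 1

/-- A circuit is a finite list of gates, the first gate of the list being applied first. The
circuit itself is independent of the oracle. -/
abbrev Circuit (c a n : ℕ) : Type := List (Gate c a n)

/-- The operator implemented by a circuit when the oracle is `V`. -/
def Circuit.toMatrix {c a n : ℕ} (V : Matrix (Qubits a × Qubits n) (Qubits a × Qubits n) ℂ) :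
    Circuit c a n → Matrix (Register c a n) (Register c a n) ℂ
  | [] => 1
  | g :: Q => Circuit.toMatrix V Q * g.toMatrix V

/-- The total number of queries to `V` and `V†`, controlled or not, made by a circuit. -/
def Circuit.queries {c a n : ℕ} (Q : Circuit c a n) : ℕ := (Q.map Gate.queries).sum

/-- The isometry `|b⟩ ⊗ |x⟩ ↦ |b, 0^c⟩ ⊗ |0^a⟩ ⊗ |x⟩` that initializes to zero all the ancillae
other than the first additional one. -/
def initialize0 (c a n : ℕ) : Matrix (Register (c + 1) a n) (Qubits 1 × Qubits n) ℂ :=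
  Matrix.of fun r q => if r = (Fin.cons (q.1 0) 0, (0, q.2)) then 1 else 0

/-- The `(n + 1)`-qubit operator `⟨0^(a+c)| W |0^(a+c)⟩`, where the first additional ancilla
and the system qubits are retained. -/
def retained {c a n : ℕ} (W : Matrix (Register (c + 1) a n) (Register (c + 1) a n) ℂ) :
    Matrix (Qubits 1 × Qubits n) (Qubits 1 × Qubits n) ℂ :=
  (initialize0 c a n)ᴴ * W * initialize0 c a n

/-- `W` implements the `(n + 1)`-qubit operator `U` to precision `ε` and returns all other
ancillae to zero: `‖W (|0^(a+c)⟩ ⊗ ψ) - |0^(a+c)⟩ ⊗ U ψ‖ ≤ ε ‖ψ‖` for all `ψ`. -/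
def ImplementsCleanly {c a n : ℕ} (ε : ℝ)
    (W : Matrix (Register (c + 1) a n) (Register (c + 1) a n) ℂ)
    (U : Matrix (Qubits 1 × Qubits n) (Qubits 1 × Qubits n) ℂ) : Prop :=
  ‖W * initialize0 c a n - initialize0 c a n * U‖ ≤ ε

/-- The `(n + 1)`-qubit matrix `[[√(I - A†A), A†], [A, -√(I - AA†)]]`, whose blocks are indexed
by the single ancilla qubit. -/
noncomputable def hermitianDilation {n : ℕ} (A : Matrix (Qubits n) (Qubits n) ℂ) :
    Matrix (Qubits 1 × Qubits n) (Qubits 1 × Qubits n) ℂ :=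
  Matrix.of fun p q =>
    (!![CFC.sqrt (1 - Aᴴ * A), Aᴴ; A, -CFC.sqrt (1 - A * Aᴴ)] (p.1 0) (q.1 0)) p.2 q.2

/-- The Pauli gate `X` on the single ancilla qubit, tensored with the identity. -/
def pauliX (n : ℕ) : Matrix (Qubits 1 × Qubits n) (Qubits 1 × Qubits n) ℂ :=
  (Matrix.of fun b b' : Qubits 1 => if b 0 = b' 0 then (0 : ℂ) else 1) ⊗ₖ
    (1 : Matrix (Qubits n) (Qubits n) ℂ)

/-!
The circuit uses one additional ancilla qubit. Let `j` be the isometry `|x⟩ ↦ |0^a⟩ ⊗ |x⟩`, so that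
`A = j† V j`, and put `D = 1 - A† A`, `D' = 1 - A A†`. The target `(X ⊗ I) U_A` has the blocks
`A, -√D', √D, A†`, and `V` itself acts in this way on singular vectors up to signs, except that the
role of the value `1` of the single ancilla is played by the orthogonal complement of the range of
`j`. It therefore suffices to move this complement coherently into the range of `j`, under the
control of the additional ancilla, before and after one call of `V` (`uncomputationBlocks`).

This is fixed-point amplification. On the part of `V j` in the complement, the operator
`j† V† (1 - j j†)` has the singular values `x = √(1 - σ²)`, where `σ ≤ 1 - δ` runs over the singular
values of `A`, and an odd *real* polynomial `P(x) = x p(x²)` with `P ≈ 1` on these values is applied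
to it, so that no phase depending on `σ` appears. For `p` the Taylor polynomial of degree `k` of
`y ^ (-1 / 2)` at `1` is taken: the derivative of `P` is a positive multiple of `(1 - x²) ^ k`
(`hasDerivAt_mul_invSqrtTaylor_sq`), hence `P` is monotone for even `k`, and
`1 - P(x) ≤ (1 - x²) ^ (k + 1) = σ ^ (2 k + 2)` (`one_sub_mul_invSqrtTaylor_sq_le`). With `k` of
order `δ⁻¹ log (1 / ε)` this is of order `ε²`.

By quantum signal processing (`exists_oracleWord_oddRow`), a word with `2 k + 1` queries realizes
`p` as soon as there is a complex polynomial `q` with `(1 - y) q q* + y p² = 1`: removing a phase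
and a query lowers the degree of the pair `(q, p)`. By the monotonicity of `P` the polynomial
`(1 - y p²) / (1 - y)` is nonnegative on the whole real line, hence of the form `q q*`
(`exists_invSqrtTaylor_complement`).

For unitary `W` and `U` and an isometry `J` one has `‖W J - J U‖² ≤ 2 ‖U - J† W J‖`, so closeness of
the compressed circuit to the target, which is computed block by block in
`sum_norm_dilation_sub_uncomputationBlocks_le`, already shows that the ancillae are returned to
zero.
-/

/-! ### Nonnegative real polynomials -/

open Polynomial in
/-- A polynomial that is nonnegative off the finite zero set of another is nonnegative. -/
theorem eval_nonneg_of_forall_eval_ne_zero {B G : ℝ[X]} (hB : B ≠ 0)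
    (hG : ∀ y, B.eval y ≠ 0 → 0 ≤ G.eval y) (y : ℝ) : 0 ≤ G.eval y := by
  have hcl : IsClosed {y : ℝ | 0 ≤ G.eval y} := isClosed_le continuous_const G.continuous
  have hde : Dense {y : ℝ | 0 ≤ G.eval y} :=
    ((B.rootSet_finite ℝ).countable.dense_compl ℝ).mono fun y hy =>
      hG y (by simpa [mem_rootSet, hB] using hy)
  have : y ∈ {y : ℝ | 0 ≤ G.eval y} := by
    rw [← hcl.closure_eq, hde.closure_eq]; trivial
  exact this

open Polynomial in
/-- A real polynomial that is nonnegative on the real line is `q q*` for a complex polynomial `q`,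
where `q*` has the conjugate coefficients. -/
theorem exists_mul_conj_eq_of_nonneg (H : ℝ[X]) (hH : ∀ y, 0 ≤ H.eval y) :
    ∃ q : ℂ[X], q * q.map (starRingEnd ℂ) = H.map (algebraMap ℝ ℂ) := by
  induction hd : H.natDegree using Nat.strong_induction_on generalizing H with
  | _ d ih =>
  by_cases hd0 : d = 0
  · obtain ⟨c, rfl⟩ := natDegree_eq_zero.1 (hd.trans hd0)
    have hc : 0 ≤ c := by simpa using hH 0
    refine ⟨C (Real.sqrt c : ℂ), ?_⟩
    simp only [map_C, ← C_mul, Complex.conj_ofReal, ← Complex.ofReal_mul, Real.mul_self_sqrt hc]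
    rfl
  have hHne : H ≠ 0 := by rintro rfl; simp at hd; omega
  have hmon : ∀ B G : ℝ[X], H = B * G → B.Monic → B.natDegree = 2 →
      (∀ y, 0 ≤ B.eval y) → ∀ b : ℂ[X], b * b.map (starRingEnd ℂ) = B.map (algebraMap ℝ ℂ) →
      ∃ q : ℂ[X], q * q.map (starRingEnd ℂ) = H.map (algebraMap ℝ ℂ) := by
    intro B G hBG hB hB2 hBn b hb
    have hGne : G ≠ 0 := by rintro rfl; simp at hBG; exact hHne hBG
    have hdeg : H.natDegree = 2 + G.natDegree := by
      rw [hBG, hB.natDegree_mul' hGne, hB2]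
    have hG : ∀ y, 0 ≤ G.eval y := by
      refine eval_nonneg_of_forall_eval_ne_zero hB.ne_zero fun y hy0 => ?_
      have := hH y
      rw [hBG, eval_mul] at this
      exact nonneg_of_mul_nonneg_right this (lt_of_le_of_ne (hBn y) hy0.symm)
    obtain ⟨q, hq⟩ := ih G.natDegree (by omega) G hG rfl
    refine ⟨b * q, ?_⟩
    rw [Polynomial.map_mul, mul_mul_mul_comm, hb, hq, hBG, Polynomial.map_mul]
  obtain ⟨z, hz⟩ : ∃ z : ℂ, (H.map (algebraMap ℝ ℂ)).IsRoot z := by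
    apply IsAlgClosed.exists_root
    rw [degree_map]
    intro h
    rw [degree_eq_natDegree hHne, hd] at h
    exact hd0 (by exact_mod_cast h)
  by_cases him : z.im = 0
  · -- a real root is a minimum, hence a double root
    have hzr : z = (z.re : ℂ) := by apply Complex.ext <;> simp [him]
    set r := z.re with hr
    have hroot : H.eval r = 0 := by
      have h1 : (H.map (algebraMap ℝ ℂ)).eval (r : ℂ) = ((H.eval r : ℝ) : ℂ) := by
        rw [eval_map_algebraMap]; exact aeval_ofReal H r
      rw [IsRoot, hzr, h1] at hz
      exact_mod_cast hz
    have hder : H.derivative.eval r = 0 := by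
      have hmin : IsLocalMin (fun y => H.eval y) r :=
        Filter.Eventually.of_forall fun y => by simpa [hroot] using hH y
      exact hmin.hasDerivAt_eq_zero (H.hasDerivAt r)
    obtain ⟨G, hG⟩ := dvd_iff_isRoot.2 hroot
    have hG0 : G.eval r = 0 := by
      have := hder
      rw [hG] at this
      simpa using this
    obtain ⟨K, hK⟩ := dvd_iff_isRoot.2 hG0
    refine hmon ((X - C r) * (X - C r)) K (by rw [hG, hK, mul_assoc])
      ((monic_X_sub_C r).mul (monic_X_sub_C r)) ?_ ?_ (X - C (r : ℂ)) ?_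
    · rw [(monic_X_sub_C r).natDegree_mul (monic_X_sub_C r)]; simp
    · intro y; simp [mul_self_nonneg]
    · simp
  · -- a pair of conjugate roots
    have hev : ∀ y : ℝ, (X ^ 2 - C (2 * z.re) * X + C (‖z‖ ^ 2) : ℝ[X]).eval y
        = (y - z.re) ^ 2 + z.im ^ 2 := by
      intro y
      simp [Complex.sq_norm, Complex.normSq_apply]; ring
    obtain ⟨G, hG⟩ := quadratic_dvd_of_aeval_eq_zero_im_ne_zero H (z := z)
      (by rw [← eval_map_algebraMap]; exact hz) him
    have hform : (X ^ 2 - C (2 * z.re) * X + C (‖z‖ ^ 2) : ℝ[X])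
        = C 1 * X ^ 2 + C (-(2 * z.re)) * X + C (‖z‖ ^ 2) := by simp; ring
    refine hmon _ G hG ?_ ?_ (fun y => by rw [hev]; positivity) (X - C z) ?_
    · rw [hform, Monic, leadingCoeff_quadratic one_ne_zero]
    · rw [hform, natDegree_quadratic one_ne_zero]
    · have h1 : z + (starRingEnd ℂ) z = ((2 * z.re : ℝ) : ℂ) := by
        rw [Complex.add_conj]
      have h2 : z * (starRingEnd ℂ) z = ((‖z‖ ^ 2 : ℝ) : ℂ) := by
        rw [Complex.mul_conj, Complex.normSq_eq_norm_sq]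
      simp only [Polynomial.map_sub, Polynomial.map_add, Polynomial.map_mul, Polynomial.map_pow,
        map_X, map_C, Complex.coe_algebraMap]
      rw [← h1, ← h2]
      simp only [C_add, C_mul]
      ring

/-! ### Taylor approximation of the inverse square root -/

/-- The Taylor polynomial of degree `k` of `y ↦ y ^ (-1 / 2)` at `y = 1`. -/
noncomputable def invSqrtTaylor (k : ℕ) : Polynomial ℝ :=
  ∑ i ∈ Finset.range (k + 1),
    Polynomial.C ((Nat.centralBinom i : ℝ) / 4 ^ i) * (1 - Polynomial.X) ^ i

theorem invSqrtTaylor_succ (k : ℕ) :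
    invSqrtTaylor (k + 1) = invSqrtTaylor k +
      Polynomial.C ((Nat.centralBinom (k + 1) : ℝ) / 4 ^ (k + 1)) * (1 - Polynomial.X) ^ (k + 1) :=
  Finset.sum_range_succ _ _

theorem natDegree_invSqrtTaylor_le (k : ℕ) : (invSqrtTaylor k).natDegree ≤ k := by
  refine Polynomial.natDegree_sum_le_of_forall_le _ _ fun i hi => ?_
  have h1 : (1 - Polynomial.X : Polynomial ℝ).natDegree ≤ 1 := by
    compute_degree
  have h2 := Polynomial.natDegree_pow_le_of_le i h1
  have h3 := Polynomial.natDegree_C_mul_le ((Nat.centralBinom i : ℝ) / 4 ^ i)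
    ((1 - Polynomial.X : Polynomial ℝ) ^ i)
  have := Finset.mem_range.1 hi
  omega

theorem invSqrtTaylor_eval_one (k : ℕ) : (invSqrtTaylor k).eval 1 = 1 := by
  induction k with
  | zero => simp [invSqrtTaylor]
  | succ k ih => rw [invSqrtTaylor_succ]; simp [ih]

/-- The coefficients of the Taylor polynomial telescope in the derivative of `x p(x²)`, which
therefore has a constant sign when `k` is even. -/
theorem hasDerivAt_mul_invSqrtTaylor_sq (k : ℕ) (x : ℝ) :
    HasDerivAt (fun x => x * (invSqrtTaylor k).eval (x ^ 2))
      ((2 * k + 1) * (Nat.centralBinom k / 4 ^ k) * (1 - x ^ 2) ^ k) x := by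
  induction k with
  | zero => simpa [invSqrtTaylor] using hasDerivAt_id' x
  | succ k ih =>
    have h1 : HasDerivAt (fun x : ℝ => x * (Nat.centralBinom (k + 1) / 4 ^ (k + 1)
        * (1 - x ^ 2) ^ (k + 1)))
        (1 * (Nat.centralBinom (k + 1) / 4 ^ (k + 1) * (1 - x ^ 2) ^ (k + 1)) +
          x * (Nat.centralBinom (k + 1) / 4 ^ (k + 1) *
            ((k + 1 : ℕ) * (1 - x ^ 2) ^ k * (-(2 * x))))) x := by
      have h2 : HasDerivAt (fun x : ℝ => 1 - x ^ 2) (-(2 * x)) x := by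
        simpa using (hasDerivAt_pow 2 x).const_sub 1
      exact (hasDerivAt_id x).mul ((h2.pow (k + 1)).const_mul _)
    have hb : ((2 * k + 1) * (Nat.centralBinom k / 4 ^ k) : ℝ)
        = (2 * k + 2) * (Nat.centralBinom (k + 1) / 4 ^ (k + 1)) := by
      have := Nat.succ_mul_centralBinom_succ k
      have h3 : ((k : ℝ) + 1) * Nat.centralBinom (k + 1)
          = 2 * (2 * k + 1) * Nat.centralBinom k := by
        exact_mod_cast this
      rw [pow_succ]
      field_simp
      linarith
    refine ((ih.add h1).congr_deriv ?_).congr_of_eventuallyEq (Filter.Eventually.of_forall ?_)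
    · rw [hb]; push_cast; ring
    · intro y
      simp only [invSqrtTaylor_succ, Pi.add_apply]
      simp
      ring

theorem monotone_mul_invSqrtTaylor_sq {k : ℕ} (hk : Even k) :
    Monotone fun x : ℝ => x * (invSqrtTaylor k).eval (x ^ 2) :=
  monotone_of_hasDerivAt_nonneg (hasDerivAt_mul_invSqrtTaylor_sq k) fun x => by
    have := hk.pow_nonneg (1 - x ^ 2)
    positivity

theorem mul_invSqrtTaylor_sq_nonneg {k : ℕ} (hk : Even k) {x : ℝ} (hx : 0 ≤ x) :
    0 ≤ x * (invSqrtTaylor k).eval (x ^ 2) := by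
  simpa using monotone_mul_invSqrtTaylor_sq hk hx

theorem mul_invSqrtTaylor_sq_le_one {k : ℕ} (hk : Even k) {x : ℝ} (hx : x ≤ 1) :
    x * (invSqrtTaylor k).eval (x ^ 2) ≤ 1 := by
  simpa [invSqrtTaylor_eval_one] using monotone_mul_invSqrtTaylor_sq hk hx

theorem one_le_mul_invSqrtTaylor_sq {k : ℕ} (hk : Even k) {x : ℝ} (hx : 1 ≤ x) :
    1 ≤ x * (invSqrtTaylor k).eval (x ^ 2) := by
  simpa [invSqrtTaylor_eval_one] using monotone_mul_invSqrtTaylor_sq hk hx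

theorem one_sub_mul_invSqrtTaylor_sq_le (k : ℕ) {x : ℝ} (hx0 : 0 ≤ x) (hx1 : x ≤ 1) :
    1 - x * (invSqrtTaylor k).eval (x ^ 2) ≤ (1 - x ^ 2) ^ (k + 1) := by
  set c : ℝ := (2 * k + 1) * (Nat.centralBinom k / 4 ^ k) with hc
  set g : ℝ → ℝ := fun x => (1 - x ^ 2) ^ (k + 1) - (1 - x * (invSqrtTaylor k).eval (x ^ 2))
    with hg
  have hder : ∀ x, HasDerivAt g ((1 - x ^ 2) ^ k * (c - 2 * (k + 1) * x)) x := by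
    intro x
    have h2 : HasDerivAt (fun x : ℝ => 1 - x ^ 2) (-(2 * x)) x := by
      simpa using (hasDerivAt_pow 2 x).const_sub 1
    refine ((h2.pow (k + 1)).sub ((hasDerivAt_mul_invSqrtTaylor_sq k x).const_sub 1)).congr_deriv ?_
    push_cast
    rw [← hc]
    ring
  have hcont : Continuous g := continuous_iff_continuousAt.2 fun x => (hder x).continuousAt
  suffices h : 0 ≤ g x by simpa [hg] using h
  -- `g` vanishes at `0` and `1`, and first increases, then decreases
  rcases le_total (2 * (k + 1) * x) c with h | h
  · have hmono : MonotoneOn g (Set.Icc 0 x) := by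
      refine monotoneOn_of_deriv_nonneg (convex_Icc _ _) hcont.continuousOn
        (fun y _ => (hder y).differentiableAt.differentiableWithinAt) fun y hy => ?_
      rw [interior_Icc] at hy
      rw [(hder y).deriv]
      refine mul_nonneg (pow_nonneg ?_ _) ?_
      · nlinarith [hy.1, hy.2]
      · have : 2 * ((k : ℝ) + 1) * y ≤ 2 * (k + 1) * x := by gcongr; exact hy.2.le
        linarith
    have := hmono (Set.left_mem_Icc.2 hx0) (Set.right_mem_Icc.2 hx0) hx0
    simpa [hg] using this
  · have hanti : AntitoneOn g (Set.Icc x 1) := by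
      refine antitoneOn_of_deriv_nonpos (convex_Icc _ _) hcont.continuousOn
        (fun y _ => (hder y).differentiableAt.differentiableWithinAt) fun y hy => ?_
      rw [interior_Icc] at hy
      rw [(hder y).deriv]
      refine mul_nonpos_of_nonneg_of_nonpos (pow_nonneg ?_ _) ?_
      · nlinarith [hy.1, hy.2]
      · have : 2 * ((k : ℝ) + 1) * x ≤ 2 * (k + 1) * y := by gcongr; exact hy.1.le
        linarith
    have := hanti (Set.left_mem_Icc.2 hx1) (Set.right_mem_Icc.2 hx1) hx1
    simpa [hg, invSqrtTaylor_eval_one] using this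

open Polynomial in
/-- The Taylor polynomial `p` of even degree can be completed to a solution `(q, p)` of the
normalization identity of quantum signal processing: `1 - y p(y)²` changes sign only at `y = 1`. -/
theorem exists_invSqrtTaylor_complement {k : ℕ} (hk : Even k) :
    ∃ q : ℂ[X], q.natDegree ≤ k ∧
      (1 - X) * (q * q.map (starRingEnd ℂ)) + X * ((invSqrtTaylor k).map (algebraMap ℝ ℂ) *
        ((invSqrtTaylor k).map (algebraMap ℝ ℂ)).map (starRingEnd ℂ)) = 1 := by
  set p := invSqrtTaylor k with hp
  obtain ⟨G, hG⟩ : (X - C (1 : ℝ)) ∣ X * p ^ 2 - 1 := by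
    rw [dvd_iff_isRoot]; simp [hp, invSqrtTaylor_eval_one]
  have hev : ∀ y : ℝ, (y - 1) * G.eval y = y * p.eval y ^ 2 - 1 := by
    intro y
    have := congrArg (eval y) hG
    simpa using this.symm
  have hGne : ∀ y : ℝ, y ≠ 1 → 0 ≤ G.eval y := by
    intro y hy
    have h := hev y
    have hsq : 0 ≤ y → y * p.eval y ^ 2 = (√y * p.eval (√y ^ 2)) ^ 2 := by
      intro h0
      rw [mul_pow, Real.sq_sqrt h0]
    rcases lt_or_gt_of_ne hy with hlt | hgt
    · have : y * p.eval y ^ 2 - 1 ≤ 0 := by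
        rcases le_total y 0 with h0 | h0
        · nlinarith [sq_nonneg (p.eval y)]
        · have h1 := mul_invSqrtTaylor_sq_le_one hk (x := √y) (Real.sqrt_le_one.2 hlt.le)
          have h2 := mul_invSqrtTaylor_sq_nonneg hk (x := √y) (Real.sqrt_nonneg _)
          rw [hsq h0]
          rw [← hp] at h1 h2
          nlinarith
      by_contra hneg
      push Not at hneg
      nlinarith
    · have : 0 ≤ y * p.eval y ^ 2 - 1 := by
        have h1 := one_le_mul_invSqrtTaylor_sq hk (x := √y) (Real.one_le_sqrt.2 hgt.le)
        rw [hsq (by linarith)]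
        rw [← hp] at h1
        nlinarith
      by_contra hneg
      push Not at hneg
      nlinarith
  have hGnn : ∀ y : ℝ, 0 ≤ G.eval y :=
    eval_nonneg_of_forall_eval_ne_zero (X_sub_C_ne_zero 1) fun y hy =>
      hGne y fun h => hy (by simp [h])
  obtain ⟨q, hq⟩ := exists_mul_conj_eq_of_nonneg G hGnn
  have hpd := natDegree_invSqrtTaylor_le k
  rw [← hp] at hpd
  refine ⟨q, ?_, ?_⟩
  · have hGd : G.natDegree ≤ 2 * k := by
      have h1 : (X * p ^ 2 - 1).natDegree ≤ 2 * k + 1 := by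
        have h2 := natDegree_pow_le_of_le 2 hpd
        have h3 := natDegree_mul_le (p := (X : ℝ[X])) (q := p ^ 2)
        have h4 := natDegree_sub_le (X * p ^ 2) (1 : ℝ[X])
        simp only [natDegree_X, natDegree_one] at h3 h4
        omega
      by_cases hG0 : G = 0
      · simp [hG0]
      rw [hG, (monic_X_sub_C _).natDegree_mul' hG0, natDegree_X_sub_C] at h1
      omega
    by_cases hq0 : q = 0
    · simp [hq0]
    have h5 := congrArg natDegree hq
    rw [natDegree_mul hq0 (by simpa [Polynomial.map_eq_zero] using hq0), natDegree_map,
      natDegree_map] at h5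
    omega
  · have hpp : (p.map (algebraMap ℝ ℂ)).map (starRingEnd ℂ) = p.map (algebraMap ℝ ℂ) := by
      rw [Polynomial.map_map]
      congr 1
      ext x
      simp
    rw [hq, hpp]
    have := congrArg (Polynomial.map (algebraMap ℝ ℂ)) hG
    simp only [Polynomial.map_sub, Polynomial.map_mul, Polynomial.map_pow, map_X,
      Polynomial.map_one, map_one] at this
    linear_combination this

/-! ### Words in an oracle and its adjoint -/

/-- Operators built from an oracle `V`: `OracleWord m f` says that `f V` is a product of fixed
unitaries and of `m` factors `V` or `V†`, the same product for every `V`. -/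
inductive OracleWord {κ : Type*} [Fintype κ] [DecidableEq κ] :
    ℕ → (Matrix κ κ ℂ → Matrix κ κ ℂ) → Prop
  | fixed (U : Matrix κ κ ℂ) (hU : U ∈ Matrix.unitaryGroup κ ℂ) : OracleWord 0 fun _ => U
  | oracle : OracleWord 1 fun V => V
  | oracle_adj : OracleWord 1 fun V => Vᴴ
  | mul {m l : ℕ} {f g : Matrix κ κ ℂ → Matrix κ κ ℂ} :
      OracleWord m f → OracleWord l g → OracleWord (m + l) fun V => f V * g V

namespace OracleWord

variable {κ : Type*} [Fintype κ] [DecidableEq κ] {m : ℕ} {f : Matrix κ κ ℂ → Matrix κ κ ℂ}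

theorem mem_unitaryGroup (hf : OracleWord m f) {V : Matrix κ κ ℂ}
    (hV : V ∈ Matrix.unitaryGroup κ ℂ) : f V ∈ Matrix.unitaryGroup κ ℂ := by
  induction hf with
  | fixed U hU => exact hU
  | oracle => exact hV
  | oracle_adj => exact Unitary.star_mem hV
  | mul _ _ h1 h2 => exact mul_mem h1 h2

theorem conjTranspose (hf : OracleWord m f) : OracleWord m fun V => (f V)ᴴ := by
  induction hf with
  | fixed U hU => exact .fixed Uᴴ (Unitary.star_mem hU)
  | oracle => exact .oracle_adj
  | oracle_adj => simpa only [Matrix.conjTranspose_conjTranspose] using .oracle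
  | mul _ _ h1 h2 => simpa only [Matrix.conjTranspose_mul, add_comm] using h2.mul h1

theorem comp_conjTranspose (hf : OracleWord m f) : OracleWord m fun V => f Vᴴ := by
  induction hf with
  | fixed U hU => exact .fixed U hU
  | oracle => exact .oracle_adj
  | oracle_adj => simpa only [Matrix.conjTranspose_conjTranspose] using .oracle
  | mul _ _ h1 h2 => exact h1.mul h2

end OracleWord

/-! ### Quantum signal processing -/

section SignalProcessing

open Polynomial

variable {ι κ : Type*} [Fintype ι] [DecidableEq ι] [Fintype κ] [DecidableEq κ]

/-- The phase gate that multiplies the range of an isometry `j` by `u` and fixes its orthogonal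
complement. -/
def rangePhase (j : Matrix κ ι ℂ) (u : ℂ) : Matrix κ κ ℂ := 1 + (u - 1) • (j * jᴴ)

/-- The row `s(D) j† + t(D) A† j† V (1 - j j†)`, where `A = j† V j` and `D = 1 - A† A`. For an
isometry `j` this is the shape of `j† F` for a word `F` with an even number of queries. -/
noncomputable def evenRow (j : Matrix κ ι ℂ) (V : Matrix κ κ ℂ) (s t : ℂ[X]) : Matrix ι κ ℂ :=
  aeval (1 - (jᴴ * V * j)ᴴ * (jᴴ * V * j)) s * jᴴ +
    aeval (1 - (jᴴ * V * j)ᴴ * (jᴴ * V * j)) t *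
      ((jᴴ * V * j)ᴴ * (jᴴ * V * (1 - j * jᴴ)))

/-- The row `q(D) A† j† + p(D) j† V† (1 - j j†)`, where `A = j† V j` and `D = 1 - A† A`. For an
isometry `j` this is the shape of `j† F` for a word `F` with an odd number of queries. -/
noncomputable def oddRow (j : Matrix κ ι ℂ) (V : Matrix κ κ ℂ) (q p : ℂ[X]) : Matrix ι κ ℂ :=
  aeval (1 - (jᴴ * V * j)ᴴ * (jᴴ * V * j)) q * ((jᴴ * V * j)ᴴ * jᴴ) +
    aeval (1 - (jᴴ * V * j)ᴴ * (jᴴ * V * j)) p * (jᴴ * Vᴴ * (1 - j * jᴴ))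

variable {j : Matrix κ ι ℂ} {V : Matrix κ κ ℂ}

theorem conjTranspose_mul_rangePhase (hj : jᴴ * j = 1) (u : ℂ) :
    jᴴ * rangePhase j u = u • jᴴ := by
  rw [rangePhase, Matrix.mul_add, Matrix.mul_smul, ← Matrix.mul_assoc, hj, Matrix.one_mul,
    Matrix.mul_one, sub_smul, one_smul]
  abel

theorem compl_mul_rangePhase (hj : jᴴ * j = 1) (u : ℂ) :
    (1 - j * jᴴ) * rangePhase j u = 1 - j * jᴴ := by
  have : j * jᴴ * (j * jᴴ) = j * jᴴ := by
    rw [Matrix.mul_assoc, ← Matrix.mul_assoc jᴴ, hj, Matrix.one_mul]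
  rw [rangePhase, Matrix.mul_add, Matrix.mul_smul, Matrix.sub_mul, Matrix.sub_mul, this]
  simp

theorem rangePhase_mem_unitaryGroup (hj : jᴴ * j = 1) {u : ℂ} (hu : ‖u‖ = 1) :
    rangePhase j u ∈ Matrix.unitaryGroup κ ℂ := by
  have hp : j * jᴴ * (j * jᴴ) = j * jᴴ := by
    rw [Matrix.mul_assoc, ← Matrix.mul_assoc jᴴ, hj, Matrix.one_mul]
  have hu' : u * (starRingEnd ℂ) u = 1 := by
    rw [Complex.mul_conj, Complex.normSq_eq_norm_sq, hu]; simp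
  rw [Matrix.mem_unitaryGroup_iff, rangePhase, Matrix.star_eq_conjTranspose,
    Matrix.conjTranspose_add, Matrix.conjTranspose_smul, Matrix.conjTranspose_mul,
    Matrix.conjTranspose_conjTranspose, Matrix.conjTranspose_one, Matrix.add_mul, Matrix.mul_add,
    Matrix.mul_add, Matrix.mul_one, Matrix.mul_one, Matrix.one_mul, Matrix.mul_smul,
    Matrix.smul_mul,
    hp, add_assoc, smul_smul, ← add_smul, ← add_smul]
  simp only [star_sub, star_one, RCLike.star_def]
  rw [show (starRingEnd ℂ) u - 1 + (u - 1 + ((starRingEnd ℂ) u - 1) * (u - 1)) = 0 by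
    linear_combination hu', zero_smul, add_zero]

theorem evenRow_mul_rangePhase (hj : jᴴ * j = 1) (u : ℂ) (s t : ℂ[X]) :
    evenRow j V s t * rangePhase j u = evenRow j V (C u * s) t := by
  rw [evenRow, evenRow, Matrix.add_mul]
  simp only [Matrix.mul_assoc, conjTranspose_mul_rangePhase hj, compl_mul_rangePhase hj]
  rw [map_mul, aeval_C, Algebra.algebraMap_eq_smul_one, smul_one_mul, Matrix.mul_smul,
    Matrix.smul_mul]

theorem oddRow_mul_rangePhase (hj : jᴴ * j = 1) (u : ℂ) (q p : ℂ[X]) :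
    oddRow j V q p * rangePhase j u = oddRow j V (C u * q) p := by
  rw [oddRow, oddRow, Matrix.add_mul]
  simp only [Matrix.mul_assoc, conjTranspose_mul_rangePhase hj, compl_mul_rangePhase hj]
  rw [map_mul, aeval_C, Algebra.algebraMap_eq_smul_one, smul_one_mul, Matrix.mul_smul,
    Matrix.mul_smul, Matrix.smul_mul]

theorem oddRow_mul_oracle (hV : Vᴴ * V = 1) (q p : ℂ[X]) :
    oddRow j V q p * V = evenRow j V ((1 - X) * q + X * p) (q - p) := by
  have h1 : (jᴴ * V * j)ᴴ * jᴴ * V = (jᴴ * V * j)ᴴ * (jᴴ * V * j) * jᴴ +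
      (jᴴ * V * j)ᴴ * (jᴴ * V * (1 - j * jᴴ)) := by
    simp only [Matrix.mul_assoc, Matrix.mul_sub, Matrix.mul_one]
    abel
  have h2 : jᴴ * Vᴴ * (1 - j * jᴴ) * V = jᴴ - (jᴴ * V * j)ᴴ * jᴴ * V := by
    simp only [Matrix.conjTranspose_mul, Matrix.conjTranspose_conjTranspose, Matrix.mul_assoc,
      Matrix.mul_sub, Matrix.sub_mul, Matrix.mul_one, hV]
  rw [oddRow, Matrix.add_mul, Matrix.mul_assoc _ ((jᴴ * V * j)ᴴ * jᴴ) V,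
    Matrix.mul_assoc _ (jᴴ * Vᴴ * (1 - j * jᴴ)) V, h2, h1, evenRow]
  set M := (jᴴ * V * j)ᴴ * (jᴴ * V * j)
  rw [mul_comm (1 - X) q, mul_comm X p, map_add, map_mul, map_mul, map_sub, map_sub, aeval_X,
    map_one, sub_sub_cancel]
  simp only [Matrix.mul_add, Matrix.add_mul, Matrix.mul_sub, Matrix.sub_mul, Matrix.mul_assoc,
    Matrix.mul_one]
  abel

theorem evenRow_mul_oracle_adj (hV : V * Vᴴ = 1) (s t : ℂ[X]) :
    evenRow j V s t * Vᴴ = oddRow j V (s + X * t) (s - (1 - X) * t) := by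
  have h1 : jᴴ * Vᴴ = (jᴴ * V * j)ᴴ * jᴴ + jᴴ * Vᴴ * (1 - j * jᴴ) := by
    simp only [Matrix.conjTranspose_mul, Matrix.conjTranspose_conjTranspose, Matrix.mul_assoc,
      Matrix.mul_sub, Matrix.mul_one]
    abel
  have h2 : (jᴴ * V * j)ᴴ * (jᴴ * V * (1 - j * jᴴ)) * Vᴴ =
      (jᴴ * V * j)ᴴ * jᴴ - (jᴴ * V * j)ᴴ * (jᴴ * V * j) * (jᴴ * Vᴴ) := by
    simp only [Matrix.mul_assoc, Matrix.mul_sub, Matrix.sub_mul, Matrix.mul_one, hV]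
  rw [evenRow, Matrix.add_mul, Matrix.mul_assoc _ jᴴ, Matrix.mul_assoc _ _ Vᴴ, h2, h1, oddRow]
  set M := (jᴴ * V * j)ᴴ * (jᴴ * V * j)
  rw [mul_comm (1 - X) t, mul_comm X t, map_add, map_sub, map_mul, map_mul, map_sub, aeval_X,
    map_one, sub_sub_cancel]
  simp only [Matrix.mul_add, Matrix.add_mul, Matrix.mul_sub, Matrix.sub_mul, Matrix.mul_assoc,
    Matrix.mul_one]
  abel

theorem coeff_mul_conj_eq_zero {f : ℂ[X]} {k i : ℕ} (hf : ∀ i, k < i → f.coeff i = 0)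
    (hi : k + k < i) : (f * f.map (starRingEnd ℂ)).coeff i = 0 := by
  have hd := natDegree_le_iff_coeff_eq_zero.2 hf
  refine coeff_eq_zero_of_natDegree_lt (lt_of_le_of_lt (natDegree_mul_le.trans ?_) hi)
  exact add_le_add hd (natDegree_map_le.trans hd)

theorem coeff_mul_conj_add {f : ℂ[X]} {k : ℕ} (hf : ∀ i, k < i → f.coeff i = 0) :
    (f * f.map (starRingEnd ℂ)).coeff (k + k) = ((‖f.coeff k‖ ^ 2 : ℝ) : ℂ) := by
  have hd := natDegree_le_iff_coeff_eq_zero.2 hf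
  rw [coeff_mul_add_eq_of_natDegree_le hd (natDegree_map_le.trans hd), coeff_map, Complex.mul_conj,
    Complex.normSq_eq_norm_sq]

theorem exists_phase_mul_eq {a b : ℂ} (h : ‖a‖ = ‖b‖) : ∃ u : ℂ, ‖u‖ = 1 ∧ u * a = b := by
  by_cases ha : a = 0
  · exact ⟨1, by simp, by rw [ha, norm_zero] at h; rw [ha, mul_zero, norm_eq_zero.1 h.symm]⟩
  · exact ⟨b / a, by rw [norm_div, ← h, div_self (norm_ne_zero_iff.2 ha)], div_mul_cancel₀ b ha⟩

/-- Synthesis of even rows: the leading coefficients of a normalized pair `(s, t)` have equal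
modulus, so that a phase followed by the removal of a query lowers the degree. -/
theorem exists_oracleWord_evenRow_succ (hj : jᴴ * j = 1) {k : ℕ}
    (ih : ∀ q p : ℂ[X], (∀ i, k < i → q.coeff i = 0) → (∀ i, k < i → p.coeff i = 0) →
      (1 - X) * (q * q.map (starRingEnd ℂ)) + X * (p * p.map (starRingEnd ℂ)) = 1 →
      ∃ f, OracleWord (2 * k + 1) f ∧
        ∀ V ∈ Matrix.unitaryGroup κ ℂ, jᴴ * f V = oddRow j V q p)
    (s t : ℂ[X]) (hs : ∀ i, k + 1 < i → s.coeff i = 0) (ht : ∀ i, k + 1 ≤ i → t.coeff i = 0)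
    (hst : s * s.map (starRingEnd ℂ) + X * (1 - X) * (t * t.map (starRingEnd ℂ)) = 1) :
    ∃ f, OracleWord (2 * (k + 1)) f ∧
      ∀ V ∈ Matrix.unitaryGroup κ ℂ, jᴴ * f V = evenRow j V s t := by
  have hlead : ‖s.coeff (k + 1)‖ = ‖-t.coeff k‖ := by
    have h := congrArg (fun f => coeff f (k + 1 + (k + 1))) hst
    rw [show X * (1 - X) * (t * t.map (starRingEnd ℂ)) = X * (t * t.map (starRingEnd ℂ)) -
      X * (X * (t * t.map (starRingEnd ℂ))) by ring] at h
    simp only [coeff_add, coeff_sub] at h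
    rw [coeff_mul_conj_add hs, ← add_assoc, coeff_X_mul, coeff_X_mul,
      show k + 1 + k = k + k + 1 by ring, coeff_X_mul, coeff_mul_conj_eq_zero ht (by omega),
      coeff_mul_conj_add ht, coeff_one, if_neg (by omega)] at h
    have h' : ‖s.coeff (k + 1)‖ ^ 2 = ‖t.coeff k‖ ^ 2 := by
      have : ((‖s.coeff (k + 1)‖ ^ 2 - ‖t.coeff k‖ ^ 2 : ℝ) : ℂ) = 0 := by
        rw [Complex.ofReal_sub]; linear_combination h
      linarith [Complex.ofReal_eq_zero.1 this]
    rw [norm_neg]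
    exact (sq_eq_sq₀ (norm_nonneg _) (norm_nonneg _)).1 h'
  obtain ⟨u, hu, hus⟩ := exists_phase_mul_eq hlead
  have huu : (starRingEnd ℂ) u * u = 1 := by
    rw [mul_comm, Complex.mul_conj, Complex.normSq_eq_norm_sq, hu]; simp
  have hq : ∀ i, k < i → (C u * s + X * t).coeff i = 0 := by
    intro i hi
    obtain ⟨i, rfl⟩ : ∃ i', i = i' + 1 := ⟨i - 1, by omega⟩
    rw [coeff_add, coeff_C_mul, coeff_X_mul]
    rcases (Nat.lt_succ_iff.1 hi).eq_or_lt with rfl | hlt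
    · rw [hus, neg_add_cancel]
    · rw [hs _ (by omega), ht _ (by omega), mul_zero, add_zero]
  obtain ⟨f, hf, hfV⟩ := ih (C u * s + X * t) (C u * s - (1 - X) * t) hq
    (fun i hi => by
      rw [show C u * s - (1 - X) * t = C u * s + X * t - t by ring, coeff_sub, hq i hi,
        ht i (by omega), sub_zero])
    (by
      have hC : C ((starRingEnd ℂ) u) * C u = 1 := by rw [← C_mul, huu, C_1]
      simp only [Polynomial.map_add, Polynomial.map_sub, Polynomial.map_mul, Polynomial.map_one,
        map_X, map_C]
      linear_combination hst + s * s.map (starRingEnd ℂ) * hC)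
  refine ⟨fun V => f V * V * rangePhase j ((starRingEnd ℂ) u), ?_, fun V hV => ?_⟩
  · exact (hf.mul .oracle).mul (.fixed _ (rangePhase_mem_unitaryGroup hj (by simpa using hu)))
  · rw [← Matrix.mul_assoc, ← Matrix.mul_assoc, hfV V hV,
      oddRow_mul_oracle (Matrix.mem_unitaryGroup_iff'.1 hV), evenRow_mul_rangePhase hj]
    congr 1
    · rw [show (1 - X) * (C u * s + X * t) + X * (C u * s - (1 - X) * t) = C u * s by ring,
        ← mul_assoc, ← C_mul, huu, C_1, one_mul]
    · ring

/-- Synthesis of odd rows, by lowering the degree of the even row that remains after a phase and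
the removal of a query. -/
theorem exists_oracleWord_oddRow_of_evenRow (hj : jᴴ * j = 1) {k : ℕ}
    (ih : ∀ s t : ℂ[X], (∀ i, k < i → s.coeff i = 0) → (∀ i, k ≤ i → t.coeff i = 0) →
      s * s.map (starRingEnd ℂ) + X * (1 - X) * (t * t.map (starRingEnd ℂ)) = 1 →
      ∃ f, OracleWord (2 * k) f ∧
        ∀ V ∈ Matrix.unitaryGroup κ ℂ, jᴴ * f V = evenRow j V s t)
    (q p : ℂ[X]) (hq : ∀ i, k < i → q.coeff i = 0) (hp : ∀ i, k < i → p.coeff i = 0)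
    (hqp : (1 - X) * (q * q.map (starRingEnd ℂ)) + X * (p * p.map (starRingEnd ℂ)) = 1) :
    ∃ f, OracleWord (2 * k + 1) f ∧
      ∀ V ∈ Matrix.unitaryGroup κ ℂ, jᴴ * f V = oddRow j V q p := by
  have hlead : ‖q.coeff k‖ = ‖p.coeff k‖ := by
    have h := congrArg (fun f => coeff f (k + k + 1)) hqp
    rw [show (1 - X) * (q * q.map (starRingEnd ℂ)) = q * q.map (starRingEnd ℂ) -
      X * (q * q.map (starRingEnd ℂ)) by ring] at h
    simp only [coeff_add, coeff_sub] at h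
    rw [coeff_X_mul, coeff_X_mul, coeff_mul_conj_add hq, coeff_mul_conj_add hp,
      coeff_mul_conj_eq_zero hq (by omega), coeff_one, if_neg (by omega)] at h
    have h' : ‖q.coeff k‖ ^ 2 = ‖p.coeff k‖ ^ 2 := by
      have : ((‖q.coeff k‖ ^ 2 - ‖p.coeff k‖ ^ 2 : ℝ) : ℂ) = 0 := by
        rw [Complex.ofReal_sub]; linear_combination -h
      linarith [Complex.ofReal_eq_zero.1 this]
    exact (sq_eq_sq₀ (norm_nonneg _) (norm_nonneg _)).1 h'
  obtain ⟨u, hu, huq⟩ := exists_phase_mul_eq hlead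
  have huu : (starRingEnd ℂ) u * u = 1 := by
    rw [mul_comm, Complex.mul_conj, Complex.normSq_eq_norm_sq, hu]; simp
  have ht : ∀ i, k ≤ i → (C u * q - p).coeff i = 0 := by
    intro i hi
    rw [coeff_sub, coeff_C_mul]
    rcases hi.eq_or_lt with rfl | hlt
    · rw [huq, sub_self]
    · rw [hq _ hlt, hp _ hlt, mul_zero, sub_zero]
  obtain ⟨f, hf, hfV⟩ := ih ((1 - X) * (C u * q) + X * p) (C u * q - p)
    (fun i hi => by
      obtain ⟨i, rfl⟩ : ∃ i', i = i' + 1 := ⟨i - 1, by omega⟩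
      rw [show (1 - X) * (C u * q) + X * p = C u * q - X * (C u * q - p) by ring, coeff_sub,
        coeff_X_mul, coeff_C_mul, hq _ hi, ht i (by omega), mul_zero, sub_zero])
    ht
    (by
      have hC : C ((starRingEnd ℂ) u) * C u = 1 := by rw [← C_mul, huu, C_1]
      simp only [Polynomial.map_add, Polynomial.map_sub, Polynomial.map_mul, Polynomial.map_one,
        map_X, map_C]
      linear_combination hqp + (1 - X) * (q * q.map (starRingEnd ℂ)) * hC)
  refine ⟨fun V => f V * Vᴴ * rangePhase j ((starRingEnd ℂ) u), ?_, fun V hV => ?_⟩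
  · exact (hf.mul .oracle_adj).mul (.fixed _ (rangePhase_mem_unitaryGroup hj (by simpa using hu)))
  · rw [← Matrix.mul_assoc, ← Matrix.mul_assoc, hfV V hV,
      evenRow_mul_oracle_adj (Matrix.mem_unitaryGroup_iff.1 hV), oddRow_mul_rangePhase hj]
    congr 1
    · rw [show (1 - X) * (C u * q) + X * p + X * (C u * q - p) = C u * q by ring,
        ← mul_assoc, ← C_mul, huu, C_1, one_mul]
    · ring

theorem exists_oracleWord_evenRow (hj : jᴴ * j = 1) (k : ℕ) :
    ∀ s t : ℂ[X], (∀ i, k < i → s.coeff i = 0) → (∀ i, k ≤ i → t.coeff i = 0) →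
      s * s.map (starRingEnd ℂ) + X * (1 - X) * (t * t.map (starRingEnd ℂ)) = 1 →
      ∃ f, OracleWord (2 * k) f ∧
        ∀ V ∈ Matrix.unitaryGroup κ ℂ, jᴴ * f V = evenRow j V s t := by
  induction k with
  | zero =>
    intro s t hs ht hst
    obtain rfl : t = 0 := by ext i; exact ht i (Nat.zero_le _)
    have hs0 : s = C (s.coeff 0) :=
      eq_C_of_natDegree_le_zero (natDegree_le_iff_coeff_eq_zero.2 hs)
    have hu : ‖s.coeff 0‖ = 1 := by
      have h := coeff_mul_conj_add hs
      rw [zero_mul, mul_zero, add_zero] at hst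
      rw [hst, coeff_one, if_pos (by rfl)] at h
      have h' : ‖s.coeff 0‖ ^ 2 = 1 := by exact_mod_cast h.symm
      exact (pow_eq_one_iff_of_nonneg (norm_nonneg _) two_ne_zero).1 h'
    refine ⟨fun _ => rangePhase j (s.coeff 0), .fixed _ (rangePhase_mem_unitaryGroup hj hu),
      fun V _ => ?_⟩
    rw [conjTranspose_mul_rangePhase hj, evenRow, hs0, aeval_C, map_zero, coeff_C_zero,
      Matrix.zero_mul, add_zero, Algebra.algebraMap_eq_smul_one, Matrix.smul_mul, Matrix.one_mul]
  | succ k ih =>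
    exact exists_oracleWord_evenRow_succ hj (exists_oracleWord_oddRow_of_evenRow hj ih)

/-- Every pair `(q, p)` of polynomials of degree at most `k` with
`(1 - y) q q* + y p p* = 1` is realized, uniformly in the unitary `V`, by `2 k + 1` queries. -/
theorem exists_oracleWord_oddRow (hj : jᴴ * j = 1) {k : ℕ} {q p : ℂ[X]} (hq : q.natDegree ≤ k)
    (hp : p.natDegree ≤ k)
    (hqp : (1 - X) * (q * q.map (starRingEnd ℂ)) + X * (p * p.map (starRingEnd ℂ)) = 1) :
    ∃ f, OracleWord (2 * k + 1) f ∧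
      ∀ V ∈ Matrix.unitaryGroup κ ℂ, jᴴ * f V = oddRow j V q p :=
  exists_oracleWord_oddRow_of_evenRow hj (exists_oracleWord_evenRow hj k) q p
    (natDegree_le_iff_coeff_eq_zero.1 hq) (natDegree_le_iff_coeff_eq_zero.1 hp) hqp

end SignalProcessing

/-! ### Circuits for controlled oracle words -/

theorem controlled_eq_blockDiagonal {c a n : ℕ} (ctrl : Option (Fin c))
    (Q : Matrix (Qubits a × Qubits n) (Qubits a × Qubits n) ℂ) :
    controlled ctrl Q = (Matrix.blockDiagonal fun z : Qubits c =>
      if ∀ j ∈ ctrl, z j = 1 then Q else 1).submatrix (Equiv.prodComm _ _)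
        (Equiv.prodComm _ _) := by
  ext p q
  simp only [controlled, Matrix.of_apply, Matrix.submatrix_apply, Equiv.prodComm_apply,
    Matrix.blockDiagonal_apply, Prod.fst_swap, Prod.snd_swap]
  split_ifs with h1 h2 h3 h3 <;> first | rfl | (rw [h1] at h3; exact absurd h2 h3) |
    (rw [h1] at h3; exact absurd h3 h2)

section Controlled

variable {c a n : ℕ} (ctrl : Option (Fin c))

theorem controlled_mul (P Q : Matrix (Qubits a × Qubits n) (Qubits a × Qubits n) ℂ) :
    controlled ctrl (P * Q) = controlled ctrl P * controlled ctrl Q := by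
  simp only [controlled_eq_blockDiagonal, Matrix.submatrix_mul_equiv, ← Matrix.blockDiagonal_mul]
  congr 2
  ext1 z
  split_ifs <;> simp

theorem controlled_one :
    controlled ctrl (1 : Matrix (Qubits a × Qubits n) (Qubits a × Qubits n) ℂ) = 1 := by
  simp only [controlled_eq_blockDiagonal, ite_self]
  rw [show (fun _ : Qubits c => (1 : Matrix (Qubits a × Qubits n) (Qubits a × Qubits n) ℂ)) = 1
    from rfl, Matrix.blockDiagonal_one, Matrix.submatrix_one_equiv]

theorem controlled_conjTranspose (Q : Matrix (Qubits a × Qubits n) (Qubits a × Qubits n) ℂ) :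
    (controlled ctrl Q)ᴴ = controlled ctrl Qᴴ := by
  simp only [controlled_eq_blockDiagonal, Matrix.conjTranspose_submatrix,
    Matrix.blockDiagonal_conjTranspose]
  congr 2
  ext1 z
  split_ifs <;> simp

theorem controlled_mem_unitaryGroup {Q : Matrix (Qubits a × Qubits n) (Qubits a × Qubits n) ℂ}
    (hQ : Q ∈ Matrix.unitaryGroup _ ℂ) : controlled ctrl Q ∈ Matrix.unitaryGroup _ ℂ := by
  rw [Matrix.mem_unitaryGroup_iff, Matrix.star_eq_conjTranspose, controlled_conjTranspose,
    ← controlled_mul, ← Matrix.star_eq_conjTranspose, Matrix.mem_unitaryGroup_iff.1 hQ,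
    controlled_one]

end Controlled

theorem Circuit.toMatrix_append {c a n : ℕ}
    (V : Matrix (Qubits a × Qubits n) (Qubits a × Qubits n) ℂ) (P Q : Circuit c a n) :
    Circuit.toMatrix V (P ++ Q) = Circuit.toMatrix V Q * Circuit.toMatrix V P := by
  induction P with
  | nil => simp [Circuit.toMatrix]
  | cons g P ih => rw [List.cons_append, Circuit.toMatrix, ih, Circuit.toMatrix, Matrix.mul_assoc]

theorem Circuit.queries_append {c a n : ℕ} (P Q : Circuit c a n) :
    Circuit.queries (P ++ Q) = Circuit.queries P + Circuit.queries Q := by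
  simp [Circuit.queries]

/-- Every word in the oracle is implemented, with any choice of control, by a circuit with the same
number of queries. -/
theorem OracleWord.exists_circuit {c a n m : ℕ} (ctrl : Option (Fin c))
    {f : Matrix (Qubits a × Qubits n) (Qubits a × Qubits n) ℂ →
      Matrix (Qubits a × Qubits n) (Qubits a × Qubits n) ℂ} (hf : OracleWord m f) :
    ∃ Q : Circuit c a n, Q.queries = m ∧ ∀ V, Q.toMatrix V = controlled ctrl (f V) := by
  induction hf with
  | fixed U hU =>
    exact ⟨[.fixed ⟨_, controlled_mem_unitaryGroup ctrl hU⟩], rfl, fun V => Matrix.one_mul _⟩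
  | oracle => exact ⟨[.query false ctrl], rfl, fun V => Matrix.one_mul _⟩
  | oracle_adj => exact ⟨[.query true ctrl], rfl, fun V => Matrix.one_mul _⟩
  | mul _ _ h1 h2 =>
    obtain ⟨P, hP, hPV⟩ := h1
    obtain ⟨Q, hQ, hQV⟩ := h2
    exact ⟨Q ++ P, by rw [Circuit.queries_append, hP, hQ, add_comm], fun V => by
      rw [Circuit.toMatrix_append, hPV, hQV, controlled_mul]⟩

/-! ### Block matrices over one qubit -/

section Blocks

variable {κ : Type*}

/-- The operator on one qubit and a register `κ` whose blocks `⟨i| · |j⟩` are `M i j`. -/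
def ofBlocks (M : Matrix (Fin 2) (Fin 2) (Matrix κ κ ℂ)) :
    Matrix (Qubits 1 × κ) (Qubits 1 × κ) ℂ :=
  Matrix.of fun p q => M (p.1 0) (q.1 0) p.2 q.2

theorem ofBlocks_sub (M N : Matrix (Fin 2) (Fin 2) (Matrix κ κ ℂ)) :
    ofBlocks (M - N) = ofBlocks M - ofBlocks N := rfl

theorem ofBlocks_conjTranspose (M : Matrix (Fin 2) (Fin 2) (Matrix κ κ ℂ)) :
    (ofBlocks M)ᴴ = ofBlocks Mᴴ := rfl

theorem ofBlocks_one [DecidableEq κ] :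
    ofBlocks (1 : Matrix (Fin 2) (Fin 2) (Matrix κ κ ℂ)) = 1 := by
  ext ⟨z, x⟩ ⟨w, y⟩
  have hzw : z = w ↔ z 0 = w 0 := by rw [funext_iff]; simp
  simp only [ofBlocks, Matrix.of_apply, Matrix.one_apply, Prod.mk.injEq, hzw]
  split_ifs with h1 h2 h2 <;> simp_all [Matrix.one_apply]

variable [Fintype κ]

theorem ofBlocks_mul (M N : Matrix (Fin 2) (Fin 2) (Matrix κ κ ℂ)) :
    ofBlocks (M * N) = ofBlocks M * ofBlocks N := by
  ext p q
  simp only [ofBlocks, Matrix.of_apply, Matrix.mul_apply, Matrix.sum_apply, Fintype.sum_prod_type]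
  exact (Fintype.sum_equiv (Equiv.funUnique (Fin 1) (Fin 2)) _ _ fun z => rfl).symm

variable [DecidableEq κ]

theorem ofBlocks_mem_unitaryGroup {M : Matrix (Fin 2) (Fin 2) (Matrix κ κ ℂ)} (hM : M * Mᴴ = 1) :
    ofBlocks M ∈ Matrix.unitaryGroup (Qubits 1 × κ) ℂ := by
  rw [Matrix.mem_unitaryGroup_iff, Matrix.star_eq_conjTranspose, ofBlocks_conjTranspose,
    ← ofBlocks_mul, hM, ofBlocks_one]

/-- The isometry `|x⟩ ↦ |i⟩ ⊗ |x⟩`. -/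
def blockEmbedding (κ : Type*) [DecidableEq κ] (i : Fin 2) : Matrix (Qubits 1 × κ) κ ℂ :=
  Matrix.of fun p y => if p = (fun _ => i, y) then 1 else 0

theorem norm_le_one_of_conjTranspose_mul_self {l m : Type*} [Fintype l] [DecidableEq l] [Fintype m]
    [DecidableEq m] {B : Matrix l m ℂ} (hB : Bᴴ * B = 1) : ‖B‖ ≤ 1 := by
  have h := Matrix.l2_opNorm_conjTranspose_mul_self B
  have h1 : ‖(1 : Matrix m m ℂ)‖ ≤ 1 := by
    rw [← Matrix.diagonal_one, Matrix.l2_opNorm_diagonal]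
    exact pi_norm_le_iff_of_nonneg zero_le_one |>.2 fun i => by simp
  rw [hB] at h
  nlinarith [norm_nonneg B]

theorem norm_blockEmbedding_le (i : Fin 2) : ‖blockEmbedding κ i‖ ≤ 1 := by
  refine norm_le_one_of_conjTranspose_mul_self ?_
  ext x y
  simp [blockEmbedding, Matrix.mul_apply, Matrix.one_apply, apply_ite (starRingEnd ℂ), eq_comm]

theorem ofBlocks_eq_sum (M : Matrix (Fin 2) (Fin 2) (Matrix κ κ ℂ)) :
    ofBlocks M = ∑ i, ∑ j, blockEmbedding κ i * M i j * (blockEmbedding κ j)ᴴ := by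
  ext ⟨z, x⟩ ⟨w, y⟩
  have hz : ∀ i : Fin 2, z = (fun _ => i) ↔ z 0 = i := fun i => by rw [funext_iff]; simp
  have hw : ∀ i : Fin 2, w = (fun _ => i) ↔ w 0 = i := fun i => by rw [funext_iff]; simp
  simp only [Matrix.sum_apply, Matrix.mul_apply, blockEmbedding, ofBlocks, Matrix.of_apply,
    Matrix.conjTranspose_apply, Prod.mk.injEq, hz, hw, ite_and]
  simp [apply_ite, Finset.sum_ite_eq]

theorem norm_ofBlocks_le (M : Matrix (Fin 2) (Fin 2) (Matrix κ κ ℂ)) :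
    ‖ofBlocks M‖ ≤ ∑ i, ∑ j, ‖M i j‖ := by
  rw [ofBlocks_eq_sum]
  refine (norm_sum_le _ _).trans (Finset.sum_le_sum fun i _ => (norm_sum_le _ _).trans
    (Finset.sum_le_sum fun j _ => ?_))
  have h1 := Matrix.l2_opNorm_mul (blockEmbedding κ i * M i j) (blockEmbedding κ j)ᴴ
  have h2 := Matrix.l2_opNorm_mul (blockEmbedding κ i) (M i j)
  rw [Matrix.l2_opNorm_conjTranspose] at h1
  have hi := norm_blockEmbedding_le (κ := κ) i
  have hj := norm_blockEmbedding_le (κ := κ) j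
  calc _ ≤ _ := h1
    _ ≤ 1 * ‖M i j‖ * 1 := by gcongr; exact h2.trans (by gcongr)
    _ = _ := by ring

end Blocks

/-! ### Initialization and compression -/

/-- The isometry `|x⟩ ↦ |0^a⟩ ⊗ |x⟩`. -/
def zeroIsometry (a n : ℕ) : Matrix (Qubits a × Qubits n) (Qubits n) ℂ :=
  Matrix.of fun r y => if r = (0, y) then 1 else 0

theorem zeroBlock_eq {a n : ℕ} (U : Matrix (Qubits a × Qubits n) (Qubits a × Qubits n) ℂ) :
    zeroBlock U = (zeroIsometry a n)ᴴ * U * zeroIsometry a n := by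
  ext x y
  simp [zeroBlock, zeroIsometry, Matrix.mul_apply, apply_ite (starRingEnd ℂ)]

theorem zeroIsometry_isometry (a n : ℕ) : (zeroIsometry a n)ᴴ * zeroIsometry a n = 1 := by
  ext x y
  simp [zeroIsometry, Matrix.mul_apply, Matrix.one_apply, apply_ite (starRingEnd ℂ), eq_comm]

theorem retained_apply {c a n : ℕ} (W : Matrix (Register (c + 1) a n) (Register (c + 1) a n) ℂ)
    (p q : Qubits 1 × Qubits n) :
    retained W p q = W (Fin.cons (p.1 0) 0, (0, p.2)) (Fin.cons (q.1 0) 0, (0, q.2)) := by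
  simp [retained, initialize0, Matrix.mul_apply, apply_ite (starRingEnd ℂ)]

theorem initialize0_isometry (c a n : ℕ) : (initialize0 c a n)ᴴ * initialize0 c a n = 1 := by
  ext ⟨z, x⟩ ⟨w, y⟩
  have h := retained_apply (1 : Matrix (Register (c + 1) a n) _ ℂ) (z, x) (w, y)
  rw [retained, Matrix.mul_one] at h
  have hzw : z = w ↔ z 0 = w 0 := by rw [funext_iff]; simp
  rw [h, Matrix.one_apply, Matrix.one_apply]
  simp only [Prod.mk.injEq, true_and, Fin.cons_inj, and_true, hzw]

theorem retained_ofBlocks {a n : ℕ}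
    (M : Matrix (Fin 2) (Fin 2) (Matrix (Qubits a × Qubits n) (Qubits a × Qubits n) ℂ)) :
    retained (c := 0) (ofBlocks M) = ofBlocks (M.map zeroBlock) := by
  ext p q
  rw [retained_apply]
  rfl

theorem controlled_some_eq_ofBlocks {a n : ℕ}
    (Q : Matrix (Qubits a × Qubits n) (Qubits a × Qubits n) ℂ) :
    controlled (c := 1) (some 0) Q = ofBlocks !![1, 0; 0, Q] := by
  ext ⟨z, x⟩ ⟨w, y⟩
  have hzw : z = w ↔ z 0 = w 0 := by rw [funext_iff]; simp
  simp only [controlled, ofBlocks, Matrix.of_apply, hzw, Option.mem_some_iff, forall_eq']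
  generalize z 0 = z
  generalize w 0 = w
  fin_cases z <;> fin_cases w <;> simp

theorem controlled_none_eq_ofBlocks {a n : ℕ}
    (Q : Matrix (Qubits a × Qubits n) (Qubits a × Qubits n) ℂ) :
    controlled (c := 1) none Q = ofBlocks !![Q, 0; 0, Q] := by
  ext ⟨z, x⟩ ⟨w, y⟩
  have hzw : z = w ↔ z 0 = w 0 := by rw [funext_iff]; simp
  simp only [controlled, ofBlocks, Matrix.of_apply, hzw]
  generalize z 0 = z
  generalize w 0 = w
  fin_cases z <;> fin_cases w <;> simp

theorem hermitianDilation_eq_ofBlocks {n : ℕ} (A : Matrix (Qubits n) (Qubits n) ℂ) :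
    hermitianDilation A = ofBlocks !![CFC.sqrt (1 - Aᴴ * A), Aᴴ; A, -CFC.sqrt (1 - A * Aᴴ)] := rfl

theorem pauliX_eq_ofBlocks (n : ℕ) : pauliX n = ofBlocks !![0, 1; 1, 0] := by
  ext ⟨z, x⟩ ⟨w, y⟩
  simp only [pauliX, ofBlocks, Matrix.of_apply, Matrix.kroneckerMap_apply]
  generalize z 0 = z
  generalize w 0 = w
  fin_cases z <;> fin_cases w <;> simp

theorem zeroBlock_ofBlocks {n : ℕ}
    (M : Matrix (Fin 2) (Fin 2) (Matrix (Qubits n) (Qubits n) ℂ)) :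
    zeroBlock (ofBlocks M) = M 0 0 := rfl

/-- For a unitary `W` and a unitary `U`, a compression of `W` close to `U` leaves no room for
leakage out of the initialized subspace. -/
theorem implementsCleanly_of_norm_retained_sub_le {c a n : ℕ} {ε η : ℝ} (hε : 0 ≤ ε)
    {W : Matrix (Register (c + 1) a n) (Register (c + 1) a n) ℂ}
    {U : Matrix (Qubits 1 × Qubits n) (Qubits 1 × Qubits n) ℂ} (hW : W ∈ Matrix.unitaryGroup _ ℂ)
    (hU : U ∈ Matrix.unitaryGroup _ ℂ) (h : ‖U - retained W‖ ≤ η) (hη : 2 * η ≤ ε ^ 2) :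
    ImplementsCleanly ε W U := by
  set J := initialize0 c a n with hJdef
  have hJ : Jᴴ * J = 1 := initialize0_isometry c a n
  have hW' : Wᴴ * W = 1 := Matrix.mem_unitaryGroup_iff'.1 hW
  have hU' : Uᴴ * U = 1 := Matrix.mem_unitaryGroup_iff'.1 hU
  have hret : retained W = Jᴴ * (W * J) := by rw [retained, Matrix.mul_assoc]
  have key : (W * J - J * U)ᴴ * (W * J - J * U) =
      Uᴴ * (U - retained W) + (U - retained W)ᴴ * U := by
    have e1 : (W * J)ᴴ * (W * J) = 1 := by
      rw [Matrix.conjTranspose_mul, Matrix.mul_assoc, ← Matrix.mul_assoc Wᴴ, hW',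
        Matrix.one_mul, hJ]
    have e2 : (J * U)ᴴ * (J * U) = 1 := by
      rw [Matrix.conjTranspose_mul, Matrix.mul_assoc, ← Matrix.mul_assoc Jᴴ, hJ,
        Matrix.one_mul, hU']
    have e3 : (J * U)ᴴ * (W * J) = Uᴴ * retained W := by
      rw [Matrix.conjTranspose_mul, Matrix.mul_assoc, hret]
    have e4 : (W * J)ᴴ * (J * U) = (retained W)ᴴ * U := by
      rw [hret, Matrix.conjTranspose_mul Jᴴ, Matrix.conjTranspose_conjTranspose, Matrix.mul_assoc]
    rw [Matrix.conjTranspose_sub, Matrix.sub_mul, Matrix.mul_sub, Matrix.mul_sub, e1, e2, e3, e4,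
      Matrix.mul_sub, Matrix.conjTranspose_sub, Matrix.sub_mul, hU']
    abel
  have hnU : ‖U‖ ≤ 1 := norm_le_one_of_conjTranspose_mul_self hU'
  have hsq : ‖W * J - J * U‖ * ‖W * J - J * U‖ ≤ ε ^ 2 := by
    rw [← Matrix.l2_opNorm_conjTranspose_mul_self, key]
    have h1 := Matrix.l2_opNorm_mul Uᴴ (U - retained W)
    have h2 := Matrix.l2_opNorm_mul (U - retained W)ᴴ U
    rw [Matrix.l2_opNorm_conjTranspose] at h1 h2
    have h0 := norm_nonneg (U - retained W)
    have := norm_add_le (Uᴴ * (U - retained W)) ((U - retained W)ᴴ * U)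
    nlinarith
  exact abs_le_of_sq_le_sq' (by nlinarith) hε |>.2

/-! ### The Hermitian dilation -/

section Dilation

open Polynomial

variable {ι : Type*} [Fintype ι] [DecidableEq ι] {A : Matrix ι ι ℂ}

theorem isSelfAdjoint_one_sub_conjTranspose_mul_self (A : Matrix ι ι ℂ) :
    IsSelfAdjoint (1 - Aᴴ * A) :=
  (IsSelfAdjoint.one _).sub (IsSelfAdjoint.star_mul_self A)

theorem spectrum_one_sub_conjTranspose_mul_self {y : ℝ} (hy : y ∈ spectrum ℝ (1 - Aᴴ * A)) :
    y ≤ 1 ∧ 1 - y ≤ ‖A‖ ^ 2 := by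
  have h : 1 - y ∈ spectrum ℝ (Aᴴ * A) := by
    rw [spectrum.mem_iff] at hy ⊢
    refine fun hu => hy ?_
    convert hu.neg using 1
    simp only [map_sub, map_one]
    abel
  have h1 : 0 ≤ 1 - y := spectrum_nonneg_of_nonneg (star_mul_self_nonneg A) h
  have h2 := (spectrum.norm_le_norm_mul_of_mem h).trans
    (mul_le_of_le_one_right (norm_nonneg _) (norm_le_one_of_conjTranspose_mul_self (by simp)))
  rw [Matrix.l2_opNorm_conjTranspose_mul_self, Real.norm_of_nonneg h1] at h2
  exact ⟨by linarith, by rw [sq]; exact h2⟩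

theorem one_sub_conjTranspose_mul_self_nonneg (hA : ‖A‖ ≤ 1) : 0 ≤ 1 - Aᴴ * A := by
  rw [StarOrderedRing.nonneg_iff_spectrum_nonneg (R := ℝ) _
    (isSelfAdjoint_one_sub_conjTranspose_mul_self A)]
  intro y hy
  have h := spectrum_one_sub_conjTranspose_mul_self hy
  nlinarith [norm_nonneg A]

theorem sqrt_one_sub_eq_cfc (hA : ‖A‖ ≤ 1) :
    CFC.sqrt (1 - Aᴴ * A) = cfc Real.sqrt (1 - Aᴴ * A) := by
  have h := one_sub_conjTranspose_mul_self_nonneg hA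
  rw [CFC.sqrt_eq_real_sqrt _ h, cfcₙ_eq_cfc]

theorem mul_aeval_one_sub (A : Matrix ι ι ℂ) {R : Type*} [CommSemiring R]
    [Algebra R (Matrix ι ι ℂ)] (p : R[X]) :
    A * aeval (1 - Aᴴ * A) p = aeval (1 - A * Aᴴ) p * A := by
  induction p using Polynomial.induction_on' with
  | add p q hp hq => rw [map_add, map_add, mul_add, add_mul, hp, hq]
  | monomial i r =>
    have h : ∀ i : ℕ, A * (1 - Aᴴ * A) ^ i = (1 - A * Aᴴ) ^ i * A := by
      intro i
      have : SemiconjBy A (1 - Aᴴ * A) (1 - A * Aᴴ) := by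
        simp [SemiconjBy, mul_sub, sub_mul, mul_assoc]
      exact this.pow_right i
    rw [aeval_monomial, aeval_monomial, ← mul_assoc, ← Algebra.commutes, mul_assoc, h, mul_assoc]

/-- Both square roots are values of one interpolating polynomial, since the spectra are finite. -/
theorem mul_sqrt_one_sub (hA : ‖A‖ ≤ 1) :
    A * CFC.sqrt (1 - Aᴴ * A) = CFC.sqrt (1 - A * Aᴴ) * A := by
  have hA' : ‖Aᴴ‖ ≤ 1 := by rwa [Matrix.l2_opNorm_conjTranspose]
  have h1 := sqrt_one_sub_eq_cfc hA
  have h2 := sqrt_one_sub_eq_cfc hA'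
  have s1 := isSelfAdjoint_one_sub_conjTranspose_mul_self A
  have s2 := isSelfAdjoint_one_sub_conjTranspose_mul_self Aᴴ
  rw [Matrix.conjTranspose_conjTranspose] at h2 s2
  have hfin := (Matrix.finite_real_spectrum (A := 1 - Aᴴ * A)).union
    (Matrix.finite_real_spectrum (A := 1 - A * Aᴴ))
  set r : ℝ[X] := Lagrange.interpolate hfin.toFinset id Real.sqrt with hr
  have hev : ∀ y ∈ spectrum ℝ (1 - Aᴴ * A) ∪ spectrum ℝ (1 - A * Aᴴ), √y = r.eval y := by
    intro y hy
    exact (Lagrange.eval_interpolate_at_node Real.sqrt Function.injective_id.injOn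
      (hfin.mem_toFinset.2 hy)).symm
  rw [h1, h2, cfc_congr fun y hy => hev y (Or.inl hy), cfc_congr fun y hy => hev y (Or.inr hy),
    cfc_polynomial r _ s1, cfc_polynomial r _ s2, mul_aeval_one_sub]

theorem hermitianDilation_isHermitian {n : ℕ} (A : Matrix (Qubits n) (Qubits n) ℂ) :
    (hermitianDilation A).IsHermitian := by
  have h : ∀ B : Matrix (Qubits n) (Qubits n) ℂ, star (CFC.sqrt B) = CFC.sqrt B := fun B =>
    (IsSelfAdjoint.of_nonneg (CFC.sqrt_nonneg B)).star_eq
  rw [Matrix.IsHermitian, hermitianDilation_eq_ofBlocks, ofBlocks_conjTranspose]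
  congr 1
  ext1 i j
  fin_cases i <;> fin_cases j <;> simp [Matrix.conjTranspose_apply, h, Matrix.star_eq_conjTranspose]

theorem hermitianDilation_mem_unitaryGroup {n : ℕ} {A : Matrix (Qubits n) (Qubits n) ℂ}
    (hA : ‖A‖ ≤ 1) : hermitianDilation A ∈ Matrix.unitaryGroup (Qubits 1 × Qubits n) ℂ := by
  have hA' : ‖Aᴴ‖ ≤ 1 := by rwa [Matrix.l2_opNorm_conjTranspose]
  have p1 := CFC.sqrt_mul_sqrt_self _ (one_sub_conjTranspose_mul_self_nonneg hA)
  have p2 := CFC.sqrt_mul_sqrt_self _ (one_sub_conjTranspose_mul_self_nonneg hA')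
  have c1 := mul_sqrt_one_sub hA
  have c2 := mul_sqrt_one_sub hA'
  rw [Matrix.conjTranspose_conjTranspose] at p2 c2
  rw [Matrix.mem_unitaryGroup_iff, Matrix.star_eq_conjTranspose, hermitianDilation_isHermitian,
    hermitianDilation_eq_ofBlocks, ← ofBlocks_mul, ← ofBlocks_one]
  congr 1
  rw [Matrix.mul_fin_two, p1, c1, ← c2]
  ext1 i j
  fin_cases i <;> fin_cases j <;> simp [p2]

theorem pauliX_mul_hermitianDilation {n : ℕ} (A : Matrix (Qubits n) (Qubits n) ℂ) :
    pauliX n * hermitianDilation A =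
      ofBlocks !![A, -CFC.sqrt (1 - A * Aᴴ); CFC.sqrt (1 - Aᴴ * A), Aᴴ] := by
  rw [pauliX_eq_ofBlocks, hermitianDilation_eq_ofBlocks, ← ofBlocks_mul, Matrix.mul_fin_two]
  simp

theorem pauliX_mul_hermitianDilation_mem_unitaryGroup {n : ℕ}
    {A : Matrix (Qubits n) (Qubits n) ℂ} (hA : ‖A‖ ≤ 1) :
    pauliX n * hermitianDilation A ∈ Matrix.unitaryGroup (Qubits 1 × Qubits n) ℂ := by
  refine mul_mem ?_ (hermitianDilation_mem_unitaryGroup hA)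
  rw [pauliX_eq_ofBlocks]
  refine ofBlocks_mem_unitaryGroup ?_
  ext1 i j
  fin_cases i <;> fin_cases j <;> simp [Matrix.mul_apply, Fin.sum_univ_two]

/-- The polynomial approximation `y p(y) ≈ √y`, evaluated at `1 - A† A`. -/
theorem norm_sqrt_sub_mul_aeval_le {k : ℕ} (hk : Even k) {r : ℝ} (hr : r ≤ 1) (hA : ‖A‖ ≤ r) :
    ‖CFC.sqrt (1 - Aᴴ * A) - aeval (1 - Aᴴ * A) (invSqrtTaylor k) * (1 - Aᴴ * A)‖
      ≤ r ^ (2 * (k + 1)) := by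
  have s1 := isSelfAdjoint_one_sub_conjTranspose_mul_self A
  have hp : aeval (1 - Aᴴ * A) (invSqrtTaylor k) * (1 - Aᴴ * A)
      = cfc (invSqrtTaylor k * X).eval (1 - Aᴴ * A) := by
    rw [cfc_polynomial _ _ s1, map_mul, aeval_X]
  rw [sqrt_one_sub_eq_cfc (hA.trans hr), hp, ← cfc_sub _ _ _]
  have hr0 : 0 ≤ r := (norm_nonneg A).trans hA
  refine norm_cfc_le (by positivity) fun y hy => ?_
  obtain ⟨h1, h2⟩ := spectrum_one_sub_conjTranspose_mul_self hy
  have h2' : 1 - y ≤ r ^ 2 := h2.trans (by gcongr)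
  have h0 : 0 ≤ y := by nlinarith
  have hx0 := Real.sqrt_nonneg y
  have hx1 : √y ≤ 1 := Real.sqrt_le_one.2 h1
  have hP1 := mul_invSqrtTaylor_sq_le_one hk hx1
  have hP := one_sub_mul_invSqrtTaylor_sq_le k hx0 hx1
  rw [Real.sq_sqrt h0] at hP1 hP
  have hform : √y - (invSqrtTaylor k * X).eval y = √y * (1 - √y * (invSqrtTaylor k).eval y) := by
    simp only [eval_mul, eval_X]
    linear_combination (invSqrtTaylor k).eval y * Real.mul_self_sqrt h0
  have h1y : 0 ≤ 1 - y := by linarith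
  rw [hform, Real.norm_of_nonneg (mul_nonneg hx0 (by linarith)), pow_mul]
  calc √y * (1 - √y * (invSqrtTaylor k).eval y) ≤ 1 * (1 - y) ^ (k + 1) := by gcongr
    _ ≤ (r ^ 2) ^ (k + 1) := by rw [one_mul]; gcongr

/-- The polynomial approximation `y p(y)² ≈ 1`, evaluated at `1 - A† A`. -/
theorem norm_one_sub_aeval_mul_mul_le {k : ℕ} (hk : Even k) {r : ℝ} (hr : r ≤ 1) (hA : ‖A‖ ≤ r) :
    ‖1 - aeval (1 - Aᴴ * A) (invSqrtTaylor k) * (1 - Aᴴ * A) *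
      aeval (1 - Aᴴ * A) (invSqrtTaylor k)‖ ≤ 2 * r ^ (2 * (k + 1)) := by
  have s1 := isSelfAdjoint_one_sub_conjTranspose_mul_self A
  have hp : 1 - aeval (1 - Aᴴ * A) (invSqrtTaylor k) * (1 - Aᴴ * A) *
      aeval (1 - Aᴴ * A) (invSqrtTaylor k)
      = cfc (1 - invSqrtTaylor k * X * invSqrtTaylor k).eval (1 - Aᴴ * A) := by
    rw [cfc_polynomial _ _ s1, map_sub, map_one, map_mul, map_mul, aeval_X]
  rw [hp]
  have hr0 : 0 ≤ r := (norm_nonneg A).trans hA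
  refine norm_cfc_le (by positivity) fun y hy => ?_
  obtain ⟨h1, h2⟩ := spectrum_one_sub_conjTranspose_mul_self hy
  have h2' : 1 - y ≤ r ^ 2 := h2.trans (by gcongr)
  have h0 : 0 ≤ y := by nlinarith
  have hx0 := Real.sqrt_nonneg y
  have hx1 : √y ≤ 1 := Real.sqrt_le_one.2 h1
  have hP1 := mul_invSqrtTaylor_sq_le_one hk hx1
  have hP0 := mul_invSqrtTaylor_sq_nonneg hk hx0
  have hP := one_sub_mul_invSqrtTaylor_sq_le k hx0 hx1
  rw [Real.sq_sqrt h0] at hP1 hP hP0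
  have hform : (1 - invSqrtTaylor k * X * invSqrtTaylor k).eval y =
      (1 + √y * (invSqrtTaylor k).eval y) * (1 - √y * (invSqrtTaylor k).eval y) := by
    simp only [eval_mul, eval_X, eval_sub, eval_one]
    linear_combination (invSqrtTaylor k).eval y ^ 2 * Real.mul_self_sqrt h0
  have h1y : 0 ≤ 1 - y := by linarith
  rw [hform, Real.norm_of_nonneg (mul_nonneg (by linarith) (by linarith)), pow_mul]
  calc _ ≤ 2 * (1 - y) ^ (k + 1) := by gcongr; linarith
    _ ≤ 2 * (r ^ 2) ^ (k + 1) := by gcongr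

end Dilation

/-! ### Amplification and the block structure of the circuit -/

section Amplification

open Polynomial

theorem compl_conjTranspose {ι κ : Type*} [Fintype ι] [DecidableEq κ] (j : Matrix κ ι ℂ) :
    (1 - j * jᴴ)ᴴ = 1 - j * jᴴ := by
  simp

theorem conjTranspose_mul_cancel {ι κ l : Type*} [Fintype ι] [DecidableEq ι] [Fintype κ]
    {j : Matrix κ ι ℂ} (hj : jᴴ * j = 1) (X : Matrix ι l ℂ) :
    jᴴ * (j * X) = X := by
  rw [← Matrix.mul_assoc, hj, Matrix.one_mul]

variable {ι κ : Type*} [Fintype ι] [Fintype κ] [DecidableEq κ]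

/-- Flips one qubit on the orthogonal complement of the range of `j`. -/
def complFlip (j : Matrix κ ι ℂ) : Matrix (Fin 2) (Fin 2) (Matrix κ κ ℂ) :=
  !![j * jᴴ, 1 - j * jᴴ; 1 - j * jᴴ, j * jᴴ]

/-- The whole circuit as a block matrix over the extra qubit. For the value `1` of this qubit `-G`
moves the range of `j` into its orthogonal complement before the oracle call, and `F` moves the
complement back into the range after it; the flips around the call exchange "extra qubit `1`" with
"orthogonal to the range of `j`". -/
def uncomputationBlocks (j : Matrix κ ι ℂ) (V F G : Matrix κ κ ℂ) :
    Matrix (Fin 2) (Fin 2) (Matrix κ κ ℂ) :=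
  !![1, 0; 0, F] * (complFlip j * (!![V, 0; 0, V] * (complFlip j * !![1, 0; 0, -G])))

theorem uncomputationBlocks_eq (j : Matrix κ ι ℂ) (V F G : Matrix κ κ ℂ) :
    uncomputationBlocks j V F G =
      !![j * jᴴ * (V * (j * jᴴ)) + (1 - j * jᴴ) * (V * (1 - j * jᴴ)),
        -(j * jᴴ * (V * ((1 - j * jᴴ) * G)) + (1 - j * jᴴ) * (V * (j * jᴴ * G)));
        F * ((1 - j * jᴴ) * (V * (j * jᴴ)) + j * jᴴ * (V * (1 - j * jᴴ))),
        -(F * ((1 - j * jᴴ) * (V * ((1 - j * jᴴ) * G)) + j * jᴴ * (V * (j * jᴴ * G))))] := by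
  rw [uncomputationBlocks, complFlip]
  simp only [Matrix.mul_fin_two, zero_mul, mul_zero, add_zero, zero_add, one_mul, mul_one, mul_neg,
    neg_zero, ← neg_add]

theorem uncomputationBlocks_one_one (j : Matrix κ ι ℂ) (V F G : Matrix κ κ ℂ) :
    jᴴ * uncomputationBlocks j V F G 1 1 * j =
      -(jᴴ * F * (1 - j * jᴴ) * (V * ((1 - j * jᴴ) * G * j))) -
        (jᴴ * F * j) * (jᴴ * V * j) * (jᴴ * G * j) := by
  rw [uncomputationBlocks_eq]
  simp only [Matrix.of_apply, Matrix.cons_val_one, Matrix.cons_val_fin_one, Matrix.mul_add,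
    Matrix.add_mul, Matrix.mul_neg, Matrix.neg_mul, Matrix.mul_assoc]
  abel

variable [DecidableEq ι] {j : Matrix κ ι ℂ}

theorem conjTranspose_mul_compl (hj : jᴴ * j = 1) : jᴴ * (1 - j * jᴴ) = 0 := by
  rw [Matrix.mul_sub, ← Matrix.mul_assoc, hj, Matrix.mul_one, Matrix.one_mul, sub_self]

theorem compl_mul_self (hj : jᴴ * j = 1) : (1 - j * jᴴ) * j = 0 := by
  rw [Matrix.sub_mul, Matrix.mul_assoc, hj, Matrix.mul_one, Matrix.one_mul, sub_self]

theorem compl_mul_compl (hj : jᴴ * j = 1) : (1 - j * jᴴ) * (1 - j * jᴴ) = 1 - j * jᴴ := by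
  rw [Matrix.mul_sub, Matrix.mul_one, ← Matrix.mul_assoc, compl_mul_self hj, Matrix.zero_mul,
    sub_zero]

theorem conjTranspose_mul_compl_mul (hj : jᴴ * j = 1) {l : Type*} (X : Matrix κ l ℂ) :
    jᴴ * ((1 - j * jᴴ) * X) = 0 := by
  rw [← Matrix.mul_assoc, conjTranspose_mul_compl hj, Matrix.zero_mul]

/-- Fixed-point amplification: a word `F` with `2 k + 1` queries that moves the part of `V j`
orthogonal to the range of `j` into that range. The result is `j D p(D) ≈ j √D` up to a component
orthogonal to the range of `j`, with `D = 1 - A† A` and `A = j† V j`. -/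
theorem exists_oracleWord_amplification (hj : jᴴ * j = 1) {k : ℕ} (hk : Even k) :
    ∃ f, OracleWord (2 * k + 1) f ∧ ∀ V ∈ Matrix.unitaryGroup κ ℂ,
      jᴴ * f V * (1 - j * jᴴ) =
        aeval (1 - (jᴴ * V * j)ᴴ * (jᴴ * V * j)) (invSqrtTaylor k) *
          (jᴴ * Vᴴ * (1 - j * jᴴ)) := by
  obtain ⟨q, hq, hqp⟩ := exists_invSqrtTaylor_complement hk
  obtain ⟨f, hf, hfV⟩ := exists_oracleWord_oddRow hj hq
    (natDegree_map_le.trans (natDegree_invSqrtTaylor_le k)) hqp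
  refine ⟨f, hf, fun V hV => ?_⟩
  rw [hfV V hV, oddRow, aeval_map_algebraMap, Matrix.add_mul]
  simp only [Matrix.mul_assoc, conjTranspose_mul_compl hj, compl_mul_compl hj, Matrix.mul_zero,
    zero_add]

variable {V : Matrix κ κ ℂ}

theorem leak_mul_oracle_mul (hj : jᴴ * j = 1) (hV : Vᴴ * V = 1) :
    jᴴ * Vᴴ * (1 - j * jᴴ) * (V * j) = 1 - (jᴴ * V * j)ᴴ * (jᴴ * V * j) := by
  have e : jᴴ * (Vᴴ * (V * j)) = 1 := by rw [← Matrix.mul_assoc Vᴴ, hV, Matrix.one_mul, hj]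
  simp only [Matrix.mul_sub, Matrix.sub_mul, Matrix.mul_assoc, Matrix.mul_one,
    Matrix.conjTranspose_mul, Matrix.conjTranspose_conjTranspose, e]

theorem isSelfAdjoint_aeval_one_sub (A : Matrix ι ι ℂ) (p : ℝ[X]) :
    (aeval (1 - Aᴴ * A) p)ᴴ = aeval (1 - Aᴴ * A) p := by
  have s := isSelfAdjoint_one_sub_conjTranspose_mul_self A
  rw [← cfc_polynomial p _ s]
  exact (cfc_predicate p.eval (1 - Aᴴ * A)).star_eq

/-- The row `j† F` of a unitary has norm one, so the part of `F` that stays in the range of `j` is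
small once the transferred part is close to an isometry. -/
theorem norm_compression_mul_self (hj : jᴴ * j = 1) (hV : Vᴴ * V = 1) {F : Matrix κ κ ℂ}
    (hF : F * Fᴴ = 1) {P : Matrix ι ι ℂ} (hP : Pᴴ = P)
    (hFP : jᴴ * F * (1 - j * jᴴ) = P * (jᴴ * Vᴴ * (1 - j * jᴴ))) :
    ‖jᴴ * F * j‖ * ‖jᴴ * F * j‖ =
      ‖1 - P * (1 - (jᴴ * V * j)ᴴ * (jᴴ * V * j)) * P‖ := by
  have h1 : (jᴴ * F * j) * (jᴴ * F * j)ᴴ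
      = 1 - (jᴴ * F * (1 - j * jᴴ)) * (jᴴ * F * (1 - j * jᴴ))ᴴ := by
    have e1 : (jᴴ * F * (1 - j * jᴴ)) * (jᴴ * F * (1 - j * jᴴ))ᴴ
        = jᴴ * F * ((1 - j * jᴴ) * (1 - j * jᴴ)) * (Fᴴ * j) := by
      simp only [Matrix.conjTranspose_mul, Matrix.conjTranspose_conjTranspose,
        compl_conjTranspose, Matrix.mul_assoc]
    have e2 : jᴴ * F * (Fᴴ * j) = 1 := by
      rw [Matrix.mul_assoc, ← Matrix.mul_assoc F, hF, Matrix.one_mul, hj]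
    rw [e1, compl_mul_compl hj, Matrix.mul_sub, Matrix.sub_mul, Matrix.mul_one, e2, sub_sub_cancel]
    simp only [Matrix.conjTranspose_mul, Matrix.conjTranspose_conjTranspose, Matrix.mul_assoc]
  have h2 : (jᴴ * F * (1 - j * jᴴ)) * (jᴴ * F * (1 - j * jᴴ))ᴴ
      = P * (1 - (jᴴ * V * j)ᴴ * (jᴴ * V * j)) * P := by
    have e : (1 - j * jᴴ) * ((1 - j * jᴴ) * (V * (j * P))) = (1 - j * jᴴ) * (V * (j * P)) := by
      rw [← Matrix.mul_assoc, compl_mul_compl hj]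
    rw [← leak_mul_oracle_mul hj hV, hFP, Matrix.conjTranspose_mul P, hP]
    simp only [Matrix.conjTranspose_mul, Matrix.conjTranspose_conjTranspose,
      compl_conjTranspose, Matrix.mul_assoc, e]
  rw [← h2, ← h1, ← Matrix.l2_opNorm_conjTranspose (jᴴ * F * j),
    ← Matrix.l2_opNorm_conjTranspose_mul_self, Matrix.conjTranspose_conjTranspose]

theorem complFlip_mul_conjTranspose (hj : jᴴ * j = 1) : complFlip j * (complFlip j)ᴴ = 1 := by
  have h1 : j * jᴴ * (j * jᴴ) = j * jᴴ := by
    rw [Matrix.mul_assoc, conjTranspose_mul_cancel hj]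
  ext1 i l
  fin_cases i <;> fin_cases l <;>
    simp [complFlip, Matrix.mul_apply, Fin.sum_univ_two, Matrix.star_eq_conjTranspose, sub_mul,
      mul_sub, h1]

variable {F G : Matrix κ κ ℂ}

theorem uncomputationBlocks_zero_zero (hj : jᴴ * j = 1) :
    jᴴ * uncomputationBlocks j V F G 0 0 * j = jᴴ * V * j := by
  rw [uncomputationBlocks_eq]
  simp only [Matrix.of_apply, Matrix.cons_val_zero, Matrix.mul_add, Matrix.mul_assoc,
    conjTranspose_mul_cancel hj, conjTranspose_mul_compl_mul hj, hj,
    Matrix.mul_one, add_zero]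

theorem uncomputationBlocks_zero_one (hj : jᴴ * j = 1) :
    jᴴ * uncomputationBlocks j V F G 0 1 * j = -(jᴴ * V * ((1 - j * jᴴ) * G * j)) := by
  rw [uncomputationBlocks_eq]
  simp only [Matrix.of_apply, Matrix.cons_val_zero, Matrix.cons_val_one, Matrix.mul_add,
    Matrix.mul_neg, Matrix.neg_mul, Matrix.mul_assoc, conjTranspose_mul_cancel hj,
    conjTranspose_mul_compl_mul hj, add_zero]

theorem uncomputationBlocks_one_zero (hj : jᴴ * j = 1) :
    jᴴ * uncomputationBlocks j V F G 1 0 * j = jᴴ * F * (1 - j * jᴴ) * (V * j) := by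
  rw [uncomputationBlocks_eq]
  simp only [Matrix.of_apply, Matrix.cons_val_zero, Matrix.cons_val_one, Matrix.mul_add,
    Matrix.add_mul]
  simp only [Matrix.mul_assoc, compl_mul_self hj, hj, Matrix.mul_zero, add_zero, Matrix.mul_one]

theorem norm_mul_conjTranspose_add_mul_mul_le {A : Matrix ι ι ℂ} (hA : ‖A‖ ≤ 1)
    (X Y Z : Matrix ι ι ℂ) : ‖X * Aᴴ + Y * A * Z‖ ≤ ‖X‖ + ‖Y‖ * ‖Z‖ := by
  have h1 := Matrix.l2_opNorm_mul X Aᴴ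
  have h2 := Matrix.l2_opNorm_mul (Y * A) Z
  have h3 := Matrix.l2_opNorm_mul Y A
  rw [Matrix.l2_opNorm_conjTranspose] at h1
  have h4 : ‖X‖ * ‖A‖ ≤ ‖X‖ := mul_le_of_le_one_right (norm_nonneg X) hA
  have h5 : ‖Y‖ * ‖A‖ ≤ ‖Y‖ := mul_le_of_le_one_right (norm_nonneg Y) hA
  have h6 : ‖Y * A‖ * ‖Z‖ ≤ ‖Y‖ * ‖Z‖ :=
    mul_le_mul_of_nonneg_right (h3.trans h5) (norm_nonneg Z)
  linarith [norm_add_le (X * Aᴴ) (Y * A * Z)]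

/-- The compressed circuit is close, block by block, to the dilation of `A = j† V j`: its blocks are
`A`, `-p(D') D'`, `p(D) D` and `p(D) D p(D) A† - (j† F j) A (j† G j)`, where `D = 1 - A† A` and
`D' = 1 - A A†`. -/
theorem sum_norm_dilation_sub_uncomputationBlocks_le (hj : jᴴ * j = 1)
    (hV : V ∈ Matrix.unitaryGroup κ ℂ) (hF : F ∈ Matrix.unitaryGroup κ ℂ)
    (hG : G ∈ Matrix.unitaryGroup κ ℂ) {k : ℕ} (hk : Even k) {r : ℝ} (hr : r ≤ 1)
    {A : Matrix ι ι ℂ} (hAV : jᴴ * V * j = A) (hA : ‖A‖ ≤ r)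
    (hFV : jᴴ * F * (1 - j * jᴴ) =
      aeval (1 - Aᴴ * A) (invSqrtTaylor k) * (jᴴ * Vᴴ * (1 - j * jᴴ)))
    (hGV : jᴴ * Gᴴ * (1 - j * jᴴ) =
      aeval (1 - A * Aᴴ) (invSqrtTaylor k) * (jᴴ * V * (1 - j * jᴴ))) :
    ∑ i, ∑ l, ‖(!![A, -CFC.sqrt (1 - A * Aᴴ); CFC.sqrt (1 - Aᴴ * A), Aᴴ] : Matrix (Fin 2) (Fin 2)
      (Matrix ι ι ℂ)) i l - jᴴ * uncomputationBlocks j V F G i l * j‖ ≤ 6 * r ^ (2 * (k + 1)) := by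
  have hA' : ‖Aᴴ‖ ≤ r := by rwa [Matrix.l2_opNorm_conjTranspose]
  have hV1 : Vᴴ * V = 1 := Matrix.mem_unitaryGroup_iff'.1 hV
  have hV3 : V * Vᴴ = 1 := Matrix.mem_unitaryGroup_iff.1 hV
  have hV2 : Vᴴᴴ * Vᴴ = 1 := by rwa [Matrix.conjTranspose_conjTranspose]
  have hAV' : jᴴ * Vᴴ * j = Aᴴ := by
    rw [← hAV]
    simp only [Matrix.conjTranspose_mul, Matrix.conjTranspose_conjTranspose, Matrix.mul_assoc]
  have hP := isSelfAdjoint_aeval_one_sub A (invSqrtTaylor k)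
  have hP' := isSelfAdjoint_aeval_one_sub Aᴴ (invSqrtTaylor k)
  have n1 := norm_sqrt_sub_mul_aeval_le hk hr hA
  have n2 := norm_sqrt_sub_mul_aeval_le hk hr hA'
  have m1 := norm_one_sub_aeval_mul_mul_le hk hr hA
  have m2 := norm_one_sub_aeval_mul_mul_le hk hr hA'
  have l1 := leak_mul_oracle_mul hj hV1
  have l2 := leak_mul_oracle_mul hj hV2
  have hcomm : aeval (1 - Aᴴ * A) (invSqrtTaylor k) * Aᴴ =
      Aᴴ * aeval (1 - A * Aᴴ) (invSqrtTaylor k) := by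
    have := mul_aeval_one_sub Aᴴ (invSqrtTaylor k)
    rw [Matrix.conjTranspose_conjTranspose] at this
    exact this.symm
  have c1 := norm_compression_mul_self hj hV1 (Matrix.mem_unitaryGroup_iff.1 hF) hP
    (by rw [hFV])
  have c2 := norm_compression_mul_self (V := Vᴴ) (F := Gᴴ) hj hV2
    (by rw [Matrix.conjTranspose_conjTranspose]; exact Matrix.mem_unitaryGroup_iff'.1 hG) hP'
    (by rw [hGV, Matrix.conjTranspose_conjTranspose, Matrix.conjTranspose_conjTranspose])
  rw [hAV] at c1 l1
  rw [hAV'] at c2 l2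
  simp only [Matrix.conjTranspose_conjTranspose] at hP' n2 m2 c2 l2
  set P := aeval (1 - Aᴴ * A) (invSqrtTaylor k)
  set P' := aeval (1 - A * Aᴴ) (invSqrtTaylor k) with hP'def
  have hGV' : (1 - j * jᴴ) * G * j = (1 - j * jᴴ) * (Vᴴ * j) * P' := by
    have := congrArg Matrix.conjTranspose hGV
    rw [Matrix.conjTranspose_mul P', hP'] at this
    simpa only [Matrix.conjTranspose_mul, Matrix.conjTranspose_conjTranspose, compl_conjTranspose,
      Matrix.mul_assoc] using this
  have hDP : (1 - A * Aᴴ) * P' = P' * (1 - A * Aᴴ) := by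
    have h := congrArg (aeval (1 - A * Aᴴ)) (mul_comm X (invSqrtTaylor k))
    rwa [map_mul, map_mul, aeval_X] at h
  have b01 : jᴴ * uncomputationBlocks j V F G 0 1 * j = -(P' * (1 - A * Aᴴ)) := by
    rw [uncomputationBlocks_zero_one hj, hGV', ← hDP, ← l2]
    simp only [Matrix.mul_assoc]
  have b10 : jᴴ * uncomputationBlocks j V F G 1 0 * j = P * (1 - Aᴴ * A) := by
    rw [uncomputationBlocks_one_zero hj, hFV, ← l1]
    simp only [Matrix.mul_assoc]
  have b11 : jᴴ * uncomputationBlocks j V F G 1 1 * j =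
      P * (1 - Aᴴ * A) * P * Aᴴ - (jᴴ * F * j) * A * (jᴴ * G * j) := by
    have e : jᴴ * Vᴴ * (1 - j * jᴴ) * (V * ((1 - j * jᴴ) * (Vᴴ * j))) = -((1 - Aᴴ * A) * Aᴴ) := by
      have e1 : V * ((1 - j * jᴴ) * (Vᴴ * j)) = j - V * j * Aᴴ := by
        rw [Matrix.sub_mul, Matrix.mul_sub, Matrix.one_mul, ← Matrix.mul_assoc V,
          hV3, Matrix.one_mul, ← hAV']
        simp only [Matrix.mul_assoc]
      rw [e1, Matrix.mul_sub, Matrix.mul_assoc _ _ j, compl_mul_self hj, Matrix.mul_zero,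
        ← Matrix.mul_assoc _ _ Aᴴ, l1, zero_sub]
    have e' : jᴴ * F * (1 - j * jᴴ) * (V * ((1 - j * jᴴ) * G * j)) =
        P * (jᴴ * Vᴴ * (1 - j * jᴴ) * (V * ((1 - j * jᴴ) * (Vᴴ * j)))) * P' := by
      rw [hFV, hGV']
      simp only [Matrix.mul_assoc]
    rw [uncomputationBlocks_one_one, hAV, e', e]
    simp only [Matrix.mul_assoc, hcomm, Matrix.mul_neg, Matrix.neg_mul, neg_neg]
  set η := r ^ (2 * (k + 1)) with hη
  have hη0 : 0 ≤ η := (norm_nonneg _).trans n1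
  have k1 : ‖Aᴴ - jᴴ * uncomputationBlocks j V F G 1 1 * j‖ ≤ 4 * η := by
    have hsplit : Aᴴ - jᴴ * uncomputationBlocks j V F G 1 1 * j =
        (1 - P * (1 - Aᴴ * A) * P) * Aᴴ + (jᴴ * F * j) * A * (jᴴ * G * j) := by
      rw [b11, Matrix.sub_mul, Matrix.one_mul]
      abel
    have hGn : ‖jᴴ * G * j‖ = ‖jᴴ * Gᴴ * j‖ := by
      rw [← Matrix.l2_opNorm_conjTranspose]
      simp only [Matrix.conjTranspose_mul, Matrix.conjTranspose_conjTranspose, Matrix.mul_assoc]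
    rw [← hGn] at c2
    have hprod : ‖jᴴ * F * j‖ * ‖jᴴ * G * j‖ ≤ 2 * η := by
      nlinarith [sq_nonneg (‖jᴴ * F * j‖ - ‖jᴴ * G * j‖)]
    rw [hsplit]
    linarith [norm_mul_conjTranspose_add_mul_mul_le (hA.trans hr)
      (1 - P * (1 - Aᴴ * A) * P) (jᴴ * F * j) (jᴴ * G * j)]
  simp only [Fin.sum_univ_two]
  simp only [Matrix.of_apply, Matrix.cons_val_zero, Matrix.cons_val_one]
  rw [uncomputationBlocks_zero_zero hj, hAV, b01, b10, sub_self, norm_zero,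
    show -CFC.sqrt (1 - A * Aᴴ) - -(P' * (1 - A * Aᴴ)) =
      -(CFC.sqrt (1 - A * Aᴴ) - P' * (1 - A * Aᴴ)) by abel, norm_neg]
  linarith

end Amplification

/-! ### The circuit -/

/-- A circuit with one additional ancilla that realizes `uncomputationBlocks` for the amplifying
word `F` of `V` and the adjoint `G` of that of `V†`. -/
theorem exists_uncomputation_circuit (a n : ℕ) {k : ℕ} (hk : Even k) :
    ∃ Q : Circuit (0 + 1) a n, Q.queries = 4 * k + 3 ∧
      ∀ (A : Matrix (Qubits n) (Qubits n) ℂ)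
        (V : Matrix (Qubits a × Qubits n) (Qubits a × Qubits n) ℂ) (r : ℝ), r ≤ 1 → ‖A‖ ≤ r →
        V ∈ Matrix.unitaryGroup _ ℂ → zeroBlock V = A →
          Q.toMatrix V ∈ Matrix.unitaryGroup _ ℂ ∧
          ‖pauliX n * hermitianDilation A - retained (Q.toMatrix V)‖ ≤ 6 * r ^ (2 * (k + 1)) ∧
          zeroBlock (retained (Q.toMatrix V)) = A := by
  set j := zeroIsometry a n with hjdef
  have hj : jᴴ * j = 1 := zeroIsometry_isometry a n
  obtain ⟨f, hf, hfV⟩ := exists_oracleWord_amplification hj hk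
  have hneg : (-1 : Matrix (Qubits a × Qubits n) (Qubits a × Qubits n) ℂ) ∈
      Matrix.unitaryGroup _ ℂ := by
    rw [Matrix.mem_unitaryGroup_iff]; simp
  have hg := (OracleWord.fixed _ hneg).mul hf.comp_conjTranspose.conjTranspose
  obtain ⟨P, hPq, hPV⟩ := hf.exists_circuit (c := 0 + 1) (some 0)
  obtain ⟨R, hRq, hRV⟩ := hg.exists_circuit (c := 0 + 1) (some 0)
  have hflip := ofBlocks_mem_unitaryGroup (complFlip_mul_conjTranspose hj)
  set flip : Circuit (0 + 1) a n := [.fixed ⟨_, hflip⟩]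
  set call : Circuit (0 + 1) a n := [.query false none]
  refine ⟨R ++ (flip ++ (call ++ (flip ++ P))), ?_, fun A V r hr hA hV hVA => ?_⟩
  · simp only [Circuit.queries_append, hPq, hRq]
    simp [flip, call, Circuit.queries, Gate.queries]
    ring
  have hflipV : flip.toMatrix V = ofBlocks (complFlip j) := Matrix.one_mul _
  have hcallV : call.toMatrix V = controlled (c := 0 + 1) none V := Matrix.one_mul _
  have hW : Circuit.toMatrix V (R ++ (flip ++ (call ++ (flip ++ P)))) =
      controlled (c := 0 + 1) (some 0) (f V) * (ofBlocks (complFlip j) *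
        (controlled (c := 0 + 1) none V * (ofBlocks (complFlip j) *
          controlled (c := 0 + 1) (some 0) (-1 * (f Vᴴ)ᴴ)))) := by
    simp only [Circuit.toMatrix_append, hPV, hRV, hflipV, hcallV, Matrix.mul_assoc]
  have hWb : Circuit.toMatrix V (R ++ (flip ++ (call ++ (flip ++ P)))) =
      ofBlocks (uncomputationBlocks j V (f V) (f Vᴴ)ᴴ) := by
    rw [hW, neg_one_mul]
    simp only [uncomputationBlocks, ofBlocks_mul, ← controlled_some_eq_ofBlocks,
      ← controlled_none_eq_ofBlocks]
  have hV' : Vᴴ ∈ Matrix.unitaryGroup _ ℂ := Unitary.star_mem hV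
  have hFu := hf.mem_unitaryGroup hV
  have hGu := hf.comp_conjTranspose.conjTranspose.mem_unitaryGroup hV
  have hAV : jᴴ * V * j = A := by rw [← zeroBlock_eq, hVA]
  have hAV' : jᴴ * Vᴴ * j = Aᴴ := by
    rw [← hAV]
    simp only [Matrix.conjTranspose_mul, Matrix.conjTranspose_conjTranspose, Matrix.mul_assoc]
  refine ⟨?_, ?_, ?_⟩
  · rw [hW]
    exact mul_mem (controlled_mem_unitaryGroup _ hFu) (mul_mem hflip
      (mul_mem (controlled_mem_unitaryGroup _ hV) (mul_mem hflip
        (controlled_mem_unitaryGroup _ (mul_mem hneg hGu)))))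
  · rw [hWb, retained_ofBlocks, pauliX_mul_hermitianDilation, ← ofBlocks_sub]
    refine (norm_ofBlocks_le _).trans ?_
    simp only [Matrix.sub_apply, Matrix.map_apply, zeroBlock_eq]
    refine sum_norm_dilation_sub_uncomputationBlocks_le hj hV hFu hGu hk hr hAV hA ?_ ?_
    · rw [hfV V hV, hAV]
    · rw [Matrix.conjTranspose_conjTranspose, hfV Vᴴ hV', hAV',
        Matrix.conjTranspose_conjTranspose, Matrix.conjTranspose_conjTranspose]
  · rw [hWb, retained_ofBlocks, zeroBlock_ofBlocks, Matrix.map_apply, zeroBlock_eq,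
      uncomputationBlocks_zero_zero hj, hAV]

theorem one_sub_pow_le_of_log_le {δ ε : ℝ} {k : ℕ} (hδ : 0 < δ) (hδ1 : δ < 1)
    (hε : 0 < ε) (hε1 : ε < 1) (hk : 2 * Real.log (2 / ε) ≤ δ * k) :
    12 * (1 - δ) ^ (2 * (k + 1)) ≤ ε ^ 2 := by
  have hδk : (1 - δ) ^ k ≤ (ε / 2) ^ 2 := by
    calc (1 - δ) ^ k ≤ Real.exp (-δ) ^ k :=
          pow_le_pow_left₀ (by linarith) (Real.one_sub_le_exp_neg δ) k
      _ = Real.exp (-(δ * k)) := by rw [← Real.exp_nat_mul]; congr 1; ring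
      _ ≤ Real.exp (-(2 * Real.log (2 / ε))) := Real.exp_le_exp.2 (by linarith)
      _ = (ε / 2) ^ 2 := by
        rw [show -(2 * Real.log (2 / ε)) = (2 : ℕ) * Real.log (ε / 2) by
          rw [← inv_div ε 2, Real.log_inv]; push_cast; ring, Real.exp_nat_mul,
          Real.exp_log (by positivity)]
  have h0 : 0 ≤ (1 - δ) ^ k := pow_nonneg (by linarith) k
  have h1 : (1 - δ) ^ (k + 1) ≤ (ε / 2) ^ 2 := by
    rw [pow_succ]; nlinarith
  have h2 : 0 ≤ (1 - δ) ^ (k + 1) := pow_nonneg (by linarith) _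
  have h3 : (ε / 2) ^ 2 ≤ ε / 4 := by nlinarith
  rw [mul_comm 2, pow_mul]
  nlinarith

theorem mainTheorem4 :
    ∃ (c : ℕ) (C : ℝ), 0 < C ∧
      ∀ (n a : ℕ) (δ ε : ℝ), 0 < δ → δ < 1 → 0 < ε → ε < 1 →
        ∃ Q : Circuit (c + 1) a n,
          (Q.queries : ℝ) ≤ C * (1 / δ) * Real.log (2 / ε) ∧
          ∀ (A : Matrix (Qubits n) (Qubits n) ℂ)
            (V : Matrix (Qubits a × Qubits n) (Qubits a × Qubits n) ℂ),
            ‖A‖ ≤ 1 - δ → IsBlockEncoding 1 0 A V →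
              (hermitianDilation A).IsHermitian ∧
              hermitianDilation A ∈ Matrix.unitaryGroup (Qubits 1 × Qubits n) ℂ ∧
              IsBlockEncoding 1 0 A (pauliX n * hermitianDilation A) ∧
              ImplementsCleanly ε (Q.toMatrix V) (pauliX n * hermitianDilation A) ∧
              ‖A - zeroBlock (retained (Q.toMatrix V))‖ ≤ ε := by
  -- A circuit with `8 ⌈L / δ⌉ + 3 ≤ 8 L / δ + 11` queries is used; `11 ≤ 16 L / δ` as `L ≥ log 2`.
  refine ⟨0, 24, by norm_num, fun n a δ ε hδ hδ1 hε hε1 => ?_⟩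
  set L := Real.log (2 / ε) with hL
  have hL2 : 11 / 16 ≤ L := by
    have h1 : Real.log 2 ≤ L := Real.log_le_log two_pos (by rw [le_div_iff₀ hε]; linarith)
    linarith [Real.log_two_gt_d9]
  have hLδ : L ≤ L / δ := by rw [le_div_iff₀ hδ]; nlinarith
  set m := ⌈L / δ⌉₊ with hm
  have hm1 : L / δ ≤ m := Nat.le_ceil _
  have hm2 : (m : ℝ) < L / δ + 1 := Nat.ceil_lt_add_one (by positivity)
  obtain ⟨Q, hQ, hQV⟩ := exists_uncomputation_circuit a n (k := 2 * m) (even_two_mul m)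
  refine ⟨Q, ?_, fun A V hA hAV => ?_⟩
  · rw [hQ, show 24 * (1 / δ) * L = 24 * (L / δ) by ring]
    push_cast
    linarith
  have hAV0 : zeroBlock V = A := by
    have h := norm_le_zero_iff.1 hAV.2
    rw [one_smul] at h
    exact (sub_eq_zero.1 h).symm
  have hA1 : ‖A‖ ≤ 1 := by linarith
  obtain ⟨hW, hn, hz⟩ := hQV A V (1 - δ) (by linarith) hA hAV.1 hAV0
  have hU := pauliX_mul_hermitianDilation_mem_unitaryGroup hA1
  refine ⟨hermitianDilation_isHermitian A, hermitianDilation_mem_unitaryGroup hA1, ⟨hU, ?_⟩,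
    implementsCleanly_of_norm_retained_sub_le hε.le hW hU hn ?_, ?_⟩
  · rw [pauliX_mul_hermitianDilation, zeroBlock_ofBlocks]
    simp
  · have := one_sub_pow_le_of_log_le (k := 2 * m) hδ hδ1 hε hε1 (by
      rw [div_le_iff₀ hδ] at hm1
      push_cast
      nlinarith)
    linarith
  · rw [hz, sub_self, norm_zero]
    exact hε.le
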